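/- Conventions. Manifolds are $C^\infty$, connected, Hausdorff and second countable, without boundary. $\mathbb{L}^{m+1}$ is $\mathbb{R}^{m+1}$ with the Lorentz product $\langle x,y\rangle=\sum_{i\le m}x_iy_i-x_{m+1}y_{m+1}$. For $c>0$ put $$\mathbb{H}^m(-c)=\{X\in\mathbb{L}^{m+1}:\langle X,X\rangle=-1/c,\ X_{m+1}>0\},\qquad \mathbb{S}^m(c)=\{Y\in\mathbb{R}^{m+1}:\langle Y,Y\rangle=1/c\},$$ with the induced metrics. An inversion of $\mathbb{R}^N$ is a map $x\mapsto b+s^2(x-b)/\|x-b\|^2$, $x\neq b$, with $b\in\mathbb{R}^N$ and $s>0$; a homothety is a map $x\mapsto a+r(x-a)$ with $a\in\mathbb{R}^N$ and $r>0$. The maps $\Theta$. Let $m+n=N$ with $m,n\ge 1$. Choose light-like vectors $p_0,w\in\mathbb{L}^{N+2}$ with $\langle p_0,w\rangle=1$ and a linear isometry $A$ of $\mathbb{R}^N$ onto $\mathrm{span}\{p_0,w\}^\perp$; then $\Psi(x)=p_0+Ax-\tfrac12\|x\|^2w$ is an isometry of $\mathbb{R}^N$ onto $\{p\in\mathbb{L}^{N+2}:\langle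 p,p\rangle=0,\ \langle p,w\rangle=1\}$. Choose further an orthogonal decomposition $\mathbb{L}^{N+2}=V\oplus W$ with $V$ time-like and linear isometries $C:\mathbb{L}^{m+1}\to V$, $D:\mathbb{R}^{n+1}\to W$. These data define $$\Theta(X,Y)=\Psi^{-1}\left(\frac{CX+DY}{\langle CX+DY,w\rangle}\right)$$ at all $(X,Y)\in\mathbb{H}^m(-c)\times\mathbb{S}^n(c)$ with $\langle CX+DY,w\rangle\ne0$, that is, at all points of $\mathbb{H}^m(-c)\times\mathbb{S}^n(c)$ except at most one. Corollary 4.4. Let $k\ge2$, let $M_1^{N_1},\dots,M_k^{N_k}$ be Riemannian manifolds of dimensions $N_i\ge1$, let $N=N_1+\dots+N_k\ge3$, and let $f:M^N=\prod_{i=1}^kM_i^{N_i}\to\mathbb{R}^N$ be a conformal local diffeomorphism of the Riemannian product. Then one of the following holds: (i) There exist local isometries $f_i:M_i^{N_i}\to\mathbb{R}^{N_i}$ $(1\le i\le k)$, an isometry $\Phi:\prod_{i=1}^k\mathbb{R}^{N_i}\to\mathbb{R}^N$, a homothety $H$ of $\mathbb{R}^N$ and a map $I$, which is either the identity of $\mathbb{R}^N$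 or an inversion of $\mathbb{R}^N$ whose centre is not in the image of $H\circ\Phi\circ(f_1\times\dots\times f_k)$, such that $f=I\circ H\circ\Phi\circ(f_1\times\dots\times f_k)$. (ii) $k=2$ and, after relabelling the factors if necessary, there exist $c>0$, local isometries $f_1:M_1^{N_1}\to\mathbb{H}^{N_1}(-c)$ and $f_2:M_2^{N_2}\to\mathbb{S}^{N_2}(c)$, and a map $\Theta$ as above (with $m=N_1$, $n=N_2$), which is a conformal diffeomorphism of its domain onto an open subset of $\mathbb{R}^N$, such that the image of $f_1\times f_2$ lies in the domain of $\Theta$ and $f=\Theta\circ(f_1\times f_2)$. -/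

import Mathlib

open scoped Manifold ContDiff

noncomputable section

/-- A smooth Riemannian metric on an `n`-dimensional manifold (without boundary). -/
abbrev RiemMetric (n : ℕ) (M : Type*) [TopologicalSpace M]
    [ChartedSpace (EuclideanSpace ℝ (Fin n)) M] [IsManifold (𝓡 n) ∞ M] : Type _ :=
  Bundle.ContMDiffRiemannianMetric (𝓡 n) ∞ (EuclideanSpace ℝ (Fin n))
    (fun x : M => TangentSpace (𝓡 n) x)

/-- The model with corners (in fact without boundary) of a finite product of manifolds of
dimensions `n i`; the product itself is `∀ i, M i` with Mathlib's product charts. -/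
abbrev prodModel {k : ℕ} (n : Fin k → ℕ) :
    ModelWithCorners ℝ (∀ i, EuclideanSpace ℝ (Fin (n i)))
      (ModelPi fun i => EuclideanSpace ℝ (Fin (n i))) :=
  ModelWithCorners.pi fun i => 𝓡 (n i)

/-- The Riemannian product metric `∑ i, πᵢ^* gᵢ` on `∀ i, M i`, where `πᵢ` is the projection
onto the `i`-th factor. -/
def productMetric {k : ℕ} {n : Fin k → ℕ} {M : Fin k → Type*}
    [∀ i, TopologicalSpace (M i)] [∀ i, ChartedSpace (EuclideanSpace ℝ (Fin (n i))) (M i)]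
    [∀ i, IsManifold (𝓡 (n i)) ∞ (M i)] (g : ∀ i, RiemMetric (n i) (M i))
    (p : ∀ i, M i) (u v : TangentSpace (prodModel n) p) : ℝ :=
  ∑ i, (g i).inner (p i)
    (mfderiv (prodModel n) (𝓡 (n i)) (fun q : ∀ j, M j => q i) p u)
    (mfderiv (prodModel n) (𝓡 (n i)) (fun q : ∀ j, M j => q i) p v)

/-- A conformal local diffeomorphism from the Riemannian product of the `(M i, g i)` into `ℝ^N`:
a smooth local diffeomorphism with `⟪df u, df v⟫ = φ² ⟨u, v⟩` for a positive function `φ`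
(which is then automatically smooth). -/
structure IsConformalLocalDiffeo {k : ℕ} {n : Fin k → ℕ} {M : Fin k → Type*}
    [∀ i, TopologicalSpace (M i)] [∀ i, ChartedSpace (EuclideanSpace ℝ (Fin (n i))) (M i)]
    [∀ i, IsManifold (𝓡 (n i)) ∞ (M i)] (g : ∀ i, RiemMetric (n i) (M i)) {N : ℕ}
    (f : (∀ i, M i) → EuclideanSpace ℝ (Fin N)) : Prop where
  isLocalDiffeomorph : IsLocalDiffeomorph (prodModel n) (𝓡 N) ∞ f
  conformal : ∃ φ : (∀ i, M i) → ℝ, (∀ p, 0 < φ p) ∧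
    ∀ (p : ∀ i, M i) (u v : TangentSpace (prodModel n) p),
      inner ℝ (mvfderiv (prodModel n) f p u) (mvfderiv (prodModel n) f p v)
        = φ p ^ 2 * productMetric g p u v

/-- A local isometry from an `n`-dimensional Riemannian manifold into Euclidean `ℝ^n`. -/
structure IsLocalIsometryEuclidean {n : ℕ} {M : Type*} [TopologicalSpace M]
    [ChartedSpace (EuclideanSpace ℝ (Fin n)) M] [IsManifold (𝓡 n) ∞ M] (g : RiemMetric n M)
    (h : M → EuclideanSpace ℝ (Fin n)) : Prop where
  isLocalDiffeomorph : IsLocalDiffeomorph (𝓡 n) (𝓡 n) ∞ h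
  isometric : ∀ (x : M) (u v : TangentSpace (𝓡 n) x),
    inner ℝ (mvfderiv (𝓡 n) h x u) (mvfderiv (𝓡 n) h x v) = g.inner x u v

/-! ### Minkowski space, hyperbolic spaces and spheres -/

/-- The underlying vector space `ℝ^(m+1)` of the Minkowski space `𝕃^(m+1)`. -/
abbrev Minkowski (m : ℕ) : Type := EuclideanSpace ℝ (Fin (m + 1))

/-- The Lorentz scalar product, of signature `(+, …, +, -)`. -/
def lorentz {m : ℕ} (x y : Minkowski m) : ℝ :=
  ∑ i : Fin m, x i.castSucc * y i.castSucc - x (Fin.last m) * y (Fin.last m)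

theorem lorentz_comm {m : ℕ} (x y : Minkowski m) : lorentz x y = lorentz y x := by
  simp only [lorentz, mul_comm]

theorem lorentz_add_left {m : ℕ} (x y z : Minkowski m) :
    lorentz (x + y) z = lorentz x z + lorentz y z := by
  simp only [lorentz, PiLp.add_apply, add_mul, Finset.sum_add_distrib]
  ring

theorem lorentz_smul_left {m : ℕ} (a : ℝ) (x y : Minkowski m) :
    lorentz (a • x) y = a * lorentz x y := by
  simp only [lorentz, PiLp.smul_apply, smul_eq_mul, mul_sub, Finset.mul_sum, mul_assoc]

theorem lorentz_add_right {m : ℕ} (x y z : Minkowski m) :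
    lorentz x (y + z) = lorentz x y + lorentz x z := by
  rw [lorentz_comm, lorentz_add_left, lorentz_comm y, lorentz_comm z]

theorem lorentz_smul_right {m : ℕ} (a : ℝ) (x y : Minkowski m) :
    lorentz x (a • y) = a * lorentz x y := by
  rw [lorentz_comm, lorentz_smul_left, lorentz_comm]

/-- The hyperbolic space `ℍ^m(-c)`: the sheet `x_{m+1} > 0` of `⟨x, x⟩ = -1/c` in `𝕃^(m+1)`. -/
def hyperbolic (m : ℕ) (c : ℝ) : Set (Minkowski m) :=
  {x | lorentz x x = -1 / c ∧ 0 < x (Fin.last m)}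

/-- The sphere `𝕊^n(c)`, given by `⟪y, y⟫ = 1/c` in `ℝ^(n+1)`. -/
def roundSphere (n : ℕ) (c : ℝ) : Set (EuclideanSpace ℝ (Fin (n + 1))) :=
  {y | inner ℝ y y = 1 / c}

/-- A local isometry from an `n`-dimensional Riemannian manifold `M` into `ℍ^n(-c)`. As `ℍ^n(-c)`
is an embedded hypersurface of `𝕃^(n+1)` whose metric is the restriction of the Lorentz product,
this is a smooth map into `𝕃^(n+1)` which takes its values in `ℍ^n(-c)` and pulls the Lorentz
product back to the metric of `M`; it is a local diffeomorphism onto `ℍ^n(-c)` since the two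
dimensions agree. -/
structure IsLocalIsometryHyperbolic {n : ℕ} {M : Type*} [TopologicalSpace M]
    [ChartedSpace (EuclideanSpace ℝ (Fin n)) M] [IsManifold (𝓡 n) ∞ M] (g : RiemMetric n M)
    (c : ℝ) (h : M → Minkowski n) : Prop where
  mem : ∀ x, h x ∈ hyperbolic n c
  contMDiff : ContMDiff (𝓡 n) 𝓘(ℝ, Minkowski n) ∞ h
  isometric : ∀ (x : M) (u v : TangentSpace (𝓡 n) x),
    lorentz (mvfderiv (𝓡 n) h x u) (mvfderiv (𝓡 n) h x v) = g.inner x u v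

/-- A local isometry from an `n`-dimensional Riemannian manifold `M` into `𝕊^n(c)`, seen as an
embedded hypersurface of `ℝ^(n+1)` with the induced metric. -/
structure IsLocalIsometrySphere {n : ℕ} {M : Type*} [TopologicalSpace M]
    [ChartedSpace (EuclideanSpace ℝ (Fin n)) M] [IsManifold (𝓡 n) ∞ M] (g : RiemMetric n M)
    (c : ℝ) (h : M → EuclideanSpace ℝ (Fin (n + 1))) : Prop where
  mem : ∀ x, h x ∈ roundSphere n c
  contMDiff : ContMDiff (𝓡 n) 𝓘(ℝ, EuclideanSpace ℝ (Fin (n + 1))) ∞ h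
  isometric : ∀ (x : M) (u v : TangentSpace (𝓡 n) x),
    inner ℝ (mvfderiv (𝓡 n) h x u) (mvfderiv (𝓡 n) h x v) = g.inner x u v

/-! ### Euclidean space in the light cone -/

/-- A triple `(p₀, w, A)`: `w` is light-like, `p₀` is light-like with `⟨p₀, w⟩ = 1`, and `A` is a
linear isometry from `ℝ^N` onto the orthogonal complement of `span {p₀, w}` in `𝕃^(N+2)` (it is
onto by dimension). -/
structure LightConeTriple (N : ℕ) where
  p₀ : Minkowski (N + 1)
  w : Minkowski (N + 1)
  A : EuclideanSpace ℝ (Fin N) →ₗ[ℝ] Minkowski (N + 1)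
  lorentz_w_w : lorentz w w = 0
  lorentz_p₀_p₀ : lorentz p₀ p₀ = 0
  lorentz_p₀_w : lorentz p₀ w = 1
  lorentz_A : ∀ x y, lorentz (A x) (A y) = inner ℝ x y
  lorentz_A_p₀ : ∀ x, lorentz (A x) p₀ = 0
  lorentz_A_w : ∀ x, lorentz (A x) w = 0

/-- The isometry `Ψ(x) = p₀ + A x - ½ ‖x‖² w` of `ℝ^N` onto the hypersurface
`𝔼^N = {p | ⟨p, p⟩ = 0, ⟨p, w⟩ = 1}` of the light cone. -/
def LightConeTriple.embed {N : ℕ} (T : LightConeTriple N) (x : EuclideanSpace ℝ (Fin N)) :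
    Minkowski (N + 1) :=
  T.p₀ + T.A x - (1 / 2 * ‖x‖ ^ 2 : ℝ) • T.w

/-- For a light-like vector `z` with `⟨z, w⟩ ≠ 0`, the point `x` of `ℝ^N` such that
`Ψ(x) = z / ⟨z, w⟩` (see `embed_toEuclidean`): its coordinates are those of `z / ⟨z, w⟩` with
respect to the orthonormal vectors `A e_j`. -/
def LightConeTriple.toEuclidean {N : ℕ} (T : LightConeTriple N) (z : Minkowski (N + 1)) :
    EuclideanSpace ℝ (Fin N) :=
  WithLp.toLp 2 fun j => lorentz z (T.A (EuclideanSpace.single j 1)) / lorentz z T.w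

theorem LightConeTriple.exists_decomp {N : ℕ} (T : LightConeTriple N) (z : Minkowski (N + 1)) :
    ∃ (a b : ℝ) (x : EuclideanSpace ℝ (Fin N)), z = a • T.p₀ + b • T.w + T.A x := by
  let L : (ℝ × ℝ) × EuclideanSpace ℝ (Fin N) →ₗ[ℝ] Minkowski (N + 1) :=
    ((LinearMap.toSpanSingleton ℝ _ T.p₀).coprod (LinearMap.toSpanSingleton ℝ _ T.w)).coprod T.A
  have hL : ∀ a b x, L ((a, b), x) = a • T.p₀ + b • T.w + T.A x := fun a b x => by
    simp [L, LinearMap.coprod_apply, LinearMap.toSpanSingleton_apply]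
  have hinj : Function.Injective L := by
    rw [injective_iff_map_eq_zero]
    rintro ⟨⟨a, b⟩, x⟩ h
    rw [hL] at h
    have hz : ∀ y, lorentz (a • T.p₀ + b • T.w + T.A x) y = 0 := fun y => by
      rw [h]; simp [lorentz]
    have ha : a = 0 := by
      simpa [lorentz_add_left, lorentz_smul_left, T.lorentz_p₀_w, T.lorentz_w_w, T.lorentz_A_w]
        using hz T.w
    have hb : b = 0 := by
      simpa [lorentz_add_left, lorentz_smul_left, lorentz_comm T.w T.p₀, T.lorentz_p₀_w,
        T.lorentz_p₀_p₀, T.lorentz_A_p₀] using hz T.p₀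
    have hx : x = 0 := by
      have := hz (T.A x)
      rw [ha, hb] at this
      simpa [T.lorentz_A] using this
    simp [ha, hb, hx]
  have hsurj : Function.Surjective L :=
    (LinearMap.injective_iff_surjective_of_finrank_eq_finrank (by simp; omega)).1 hinj
  obtain ⟨⟨⟨a, b⟩, x⟩, h⟩ := hsurj z
  exact ⟨a, b, x, by rw [← h, hL]⟩

theorem LightConeTriple.embed_toEuclidean {N : ℕ} (T : LightConeTriple N) {z : Minkowski (N + 1)}
    (hz : lorentz z z = 0) (hw : lorentz z T.w ≠ 0) :
    T.embed (T.toEuclidean z) = (lorentz z T.w)⁻¹ • z := by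
  obtain ⟨a, b, x, rfl⟩ := T.exists_decomp z
  have h1 : lorentz (a • T.p₀ + b • T.w + T.A x) T.w = a := by
    simp [lorentz_add_left, lorentz_smul_left, T.lorentz_p₀_w, T.lorentz_w_w, T.lorentz_A_w]
  have h2 : ∀ y, lorentz (a • T.p₀ + b • T.w + T.A x) (T.A y) = inner ℝ x y := fun y => by
    simp [lorentz_add_left, lorentz_smul_left, lorentz_comm T.p₀, lorentz_comm T.w,
      T.lorentz_A_w, T.lorentz_A_p₀, T.lorentz_A]
  have h3 : T.toEuclidean (a • T.p₀ + b • T.w + T.A x) = a⁻¹ • x := by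
    ext j
    simp only [LightConeTriple.toEuclidean, h1, h2]
    simp [EuclideanSpace.inner_single_right, div_eq_inv_mul]
  have h4 : 2 * a * b + ‖x‖ ^ 2 = 0 := by
    rw [← real_inner_self_eq_norm_sq, ← hz]
    simp only [lorentz_add_left, lorentz_add_right, lorentz_smul_left, lorentz_smul_right,
      T.lorentz_A, T.lorentz_A_w, T.lorentz_A_p₀, T.lorentz_p₀_p₀, T.lorentz_w_w, T.lorentz_p₀_w,
      lorentz_comm T.p₀ (T.A x), lorentz_comm T.w (T.A x), lorentz_comm T.w T.p₀]
    ring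
  rw [h1] at hw ⊢
  rw [h3, LightConeTriple.embed, norm_smul, map_smul, smul_add, smul_add, smul_smul, smul_smul,
    inv_mul_cancel₀ hw, one_smul]
  have h5 : -(1 / 2 * (‖a⁻¹‖ * ‖x‖) ^ 2) = a⁻¹ * b := by
    rw [mul_pow, Real.norm_eq_abs, sq_abs]
    field_simp
    linarith
  rw [← h5, neg_smul]
  abel

/-- An orthogonal decomposition `𝕃^(N+2) = V ⊕ W` with `V` time-like, together with linear
isometries `C : 𝕃^(m+1) → V` and `D : ℝ^(n+1) → W`, where `m + n = N` (so that the ranges of `C`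
and `D`, being orthogonal and non-degenerate, span `𝕃^(N+2)` by dimension). -/
structure LorentzSplitting (N m n : ℕ) where
  C : Minkowski m →ₗ[ℝ] Minkowski (N + 1)
  D : EuclideanSpace ℝ (Fin (n + 1)) →ₗ[ℝ] Minkowski (N + 1)
  dim : m + n = N
  lorentz_C : ∀ x y, lorentz (C x) (C y) = lorentz x y
  lorentz_D : ∀ x y, lorentz (D x) (D y) = inner ℝ x y
  lorentz_C_D : ∀ x y, lorentz (C x) (D y) = 0

/-- The map `Θ : (X, Y) ↦ Ψ⁻¹ ((C X + D Y) / ⟨C X + D Y, w⟩)` from `ℍ^m(-c) × 𝕊^n(c)` to `ℝ^N`,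
`N = m + n`, written on the ambient space. -/
def conformalTheta {N m n : ℕ} (T : LightConeTriple N) (S : LorentzSplitting N m n)
    (q : Minkowski m × EuclideanSpace ℝ (Fin (n + 1))) : EuclideanSpace ℝ (Fin N) :=
  T.toEuclidean (S.C q.1 + S.D q.2)

/-- The domain of `Θ` in `ℍ^m(-c) × 𝕊^n(c)`: all points `(X, Y)` with `⟨C X + D Y, w⟩ ≠ 0`, that
is, all points except at most one, which `Θ` sends to infinity. -/
def thetaDomain {N m n : ℕ} (T : LightConeTriple N) (S : LorentzSplitting N m n) (c : ℝ) :
    Set (Minkowski m × EuclideanSpace ℝ (Fin (n + 1))) :=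
  {q | q.1 ∈ hyperbolic m c ∧ q.2 ∈ roundSphere n c ∧ lorentz (S.C q.1 + S.D q.2) T.w ≠ 0}

/-- `Θ` maps the open subset `U` of the Riemannian product `ℍ^m(-c) × 𝕊^n(c)` conformally and
diffeomorphically onto an open subset of `ℝ^N`. Here `Θ` is given on the ambient vector space and
smooth near `U`; the tangent space of `ℍ^m(-c) × 𝕊^n(c)` at `(X, Y)` consists of the `(u, v)` with
`⟨X, u⟩ = 0` and `⟪Y, v⟫ = 0`. The inverse is smooth by the inverse function theorem. -/
structure IsConformalDiffeoOn {N m n : ℕ} (U : Set (Minkowski m × EuclideanSpace ℝ (Fin (n + 1))))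
    (Θ : Minkowski m × EuclideanSpace ℝ (Fin (n + 1)) → EuclideanSpace ℝ (Fin N)) : Prop where
  injOn : Set.InjOn Θ U
  isOpen_image : IsOpen (Θ '' U)
  contDiffAt : ∀ q ∈ U, ContDiffAt ℝ ∞ Θ q
  conformal : ∃ φ : Minkowski m × EuclideanSpace ℝ (Fin (n + 1)) → ℝ, (∀ q ∈ U, 0 < φ q) ∧
    ∀ q ∈ U, ∀ (u u' : Minkowski m) (v v' : EuclideanSpace ℝ (Fin (n + 1))),
      lorentz q.1 u = 0 → lorentz q.1 u' = 0 → inner ℝ q.2 v = 0 → inner ℝ q.2 v' = 0 →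
        inner ℝ (fderiv ℝ Θ q (u, v)) (fderiv ℝ Θ q (u', v'))
          = φ q ^ 2 * (lorentz u u' + inner ℝ v v')

end

/-! The proof linearises conformal geometry in the light cone. If `f` is conformal with factor `φ`,
then `F = φ⁻¹ • Ψ ∘ f` takes its values in the light cone of `𝕃^(N+2)`. Since `Ψ ∘ f` is light-like
and orthogonal to its own derivatives, the derivative of `φ⁻¹` does not enter the induced metric,
and `F` is an isometric immersion of the Riemannian product.

For `a`, `b` tangent to different factors, `∂ₐ∂_b F` is orthogonal to all tangent vectors, because
the mixed Christoffel symbols of a product vanish, and to `F`. It is therefore `β(a, b) F`. Symmetry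
of third derivatives, paired with `∂_c F` for a nonzero `c` orthogonal to `a` and not in the factor
of `b`, forces `β(a, b) = 0`. Such a `c` exists, possibly after interchanging `a` and `b`, because
`N ≥ 3`; this is `dirDeriv_dirDeriv_mixed_eq_zero`. Integrating twice and using connectedness,
`exists_lightCone_splitting` obtains `F p = o + ∑ i, G i (p i)` globally.

That `F` is light-like at every point makes the `G i` mutually orthogonal. Take orthonormal frames
`A i` of the factors at the base point and the light-like normal `ξ` with `⟨o, ξ⟩ = 1`. Each `G i`
lies in the span of `o`, `ξ` and the range of `A i`, and orthogonality gives `⟨G i, ξ⟩ = μᵢ ⟨G i,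
o⟩` with `μᵢ = -μⱼ` for `i ≠ j`. This is `dichotomy`.

If all `μᵢ` vanish, `F` lies in the flat section `⟨·, ξ⟩ = 1` of the cone, where the coordinates
along the `A i` are local isometries. Comparing `ξ` with the point at infinity `w` of `Ψ` gives a
homothety if they are proportional and an inversion otherwise (`exists_euclidean_form`). If some
`μᵢ` is nonzero there are only two factors, with opposite constants. Splitting `o` along `μ o - ξ`
and `μ o + ξ` puts one factor on a hyperboloid and the other on a sphere (`exists_theta_form`). -/

noncomputable section

/-! ### Charts and frames of a product manifold. -/

/-- The derivative of `G` in the constant direction `a`. -/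
def dirDeriv {X Y : Type*} [NormedAddCommGroup X] [NormedSpace ℝ X] [NormedAddCommGroup Y]
    [NormedSpace ℝ Y] (a : X) (G : X → Y) (x : X) : Y := fderiv ℝ G x a

theorem IsManifold.pi {ι : Type*} [Fintype ι] {E : ι → Type*} [∀ i, NormedAddCommGroup (E i)]
    [∀ i, NormedSpace ℝ (E i)] {H : ι → Type*} [∀ i, TopologicalSpace (H i)]
    (I : ∀ i, ModelWithCorners ℝ (E i) (H i)) (m : ℕ∞ω) (M : ι → Type*)
    [∀ i, TopologicalSpace (M i)] [∀ i, ChartedSpace (H i) (M i)] [∀ i, IsManifold (I i) m (M i)] :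
    IsManifold (ModelWithCorners.pi I) m (∀ i, M i) := by
  refine isManifold_of_contDiffOn _ _ _ ?_
  rintro _ _ ⟨e, he, rfl⟩ ⟨e', he', rfl⟩
  rw [contDiffOn_pi]
  intro i
  have h : ContDiffOn ℝ m (I i ∘ ((e i).symm ≫ₕ e' i) ∘ (I i).symm)
      ((I i).symm ⁻¹' ((e i).symm ≫ₕ e' i).source ∩ Set.range (I i)) :=
    (mem_groupoid_of_pregroupoid.1
      (HasGroupoid.compatible (G := contDiffGroupoid m (I i)) (he i trivial) (he' i trivial))).1
  refine h.comp (t := _) (f := fun x : ∀ i, E i => x i)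
    (ContinuousLinearMap.proj (R := ℝ) (φ := E) i).contDiff.contDiffOn ?_
  rintro x ⟨⟨hx1, hx2⟩, y, rfl⟩
  exact ⟨⟨hx1 i trivial, hx2 i trivial⟩, y i, rfl⟩

variable {k : ℕ} {n : Fin k → ℕ} {M : Fin k → Type*}
    [∀ i, TopologicalSpace (M i)] [∀ i, ChartedSpace (EuclideanSpace ℝ (Fin (n i))) (M i)]

theorem extChartAt_prodModel (p : ∀ i, M i) :
    extChartAt (prodModel n) p = PartialEquiv.pi fun i => extChartAt (𝓡 (n i)) (p i) := by
  ext x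
  · rfl
  · rfl
  · simp [extChartAt, PartialEquiv.pi, Set.pi, OpenPartialHomeomorph.pi]

theorem contMDiff_proj_prodModel (i : Fin k) :
    ContMDiff (prodModel n) (𝓡 (n i)) ∞ (fun q : ∀ j, M j => q i) := by
  intro p
  rw [contMDiffAt_iff]
  refine ⟨(continuous_apply i).continuousAt, ?_⟩
  have h : ContDiffWithinAt ℝ ∞ (fun x : ∀ i, EuclideanSpace ℝ (Fin (n i)) => x i)
    (Set.range (prodModel n)) (extChartAt (prodModel n) p p) :=
    (ContinuousLinearMap.proj (R := ℝ) (φ := fun i => EuclideanSpace ℝ (Fin (n i))) i).contDiff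
      |>.contDiffAt.contDiffWithinAt
  refine h.congr_of_eventuallyEq ?_ ?_
  · have := extChartAt_target_mem_nhdsWithin (I := prodModel n) p
    filter_upwards [this] with x hx
    rw [extChartAt_prodModel] at hx ⊢
    exact (extChartAt (𝓡 (n i)) (p i)).right_inv (hx i trivial)
  · rw [extChartAt_prodModel]
    exact (extChartAt (𝓡 (n i)) (p i)).right_inv (mem_extChartAt_target _)

theorem isOpen_extChartAt_prodModel_target (p : ∀ i, M i) :
    IsOpen (extChartAt (prodModel n) p).target := by
  rw [extChartAt_prodModel]
  exact isOpen_set_pi Set.finite_univ fun i _ => isOpen_extChartAt_target (p i)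

variable [∀ i, IsManifold (𝓡 (n i)) ∞ (M i)]

/-- The differential of the inverse of a chart. -/
def chartFrame {m : ℕ} {X : Type*} [TopologicalSpace X] [ChartedSpace (EuclideanSpace ℝ (Fin m)) X]
    (x : X) (y : EuclideanSpace ℝ (Fin m)) :
    EuclideanSpace ℝ (Fin m) →L[ℝ] TangentSpace (𝓡 m) ((extChartAt (𝓡 m) x).symm y) :=
  mfderiv 𝓘(ℝ, EuclideanSpace ℝ (Fin m)) (𝓡 m) (extChartAt (𝓡 m) x).symm y

section
variable {m : ℕ} {X : Type*} [TopologicalSpace X] [ChartedSpace (EuclideanSpace ℝ (Fin m)) X]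
  [IsManifold (𝓡 m) ∞ X] (x : X) {y : EuclideanSpace ℝ (Fin m)}

theorem mdifferentiableAt_extChartAt_symm_of_mem (hy : y ∈ (extChartAt (𝓡 m) x).target) :
    MDifferentiableAt 𝓘(ℝ, EuclideanSpace ℝ (Fin m)) (𝓡 m) (extChartAt (𝓡 m) x).symm y :=
  ((contMDiffOn_extChartAt_symm (n := ∞) x).contMDiffAt
    ((isOpen_extChartAt_target x).mem_nhds hy)).mdifferentiableAt (by simp)

theorem bijective_chartFrame (hy : y ∈ (extChartAt (𝓡 m) x).target) :
    Function.Bijective (chartFrame x y) := by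
  have : IsManifold (𝓡 m) 1 X := IsManifold.of_le (n := ∞) (by simp)
  have := isInvertible_mfderivWithin_extChartAt_symm (I := 𝓡 m) hy
  rw [ModelWithCorners.range_eq_univ, mfderivWithin_univ] at this
  exact this.bijective

theorem dirDeriv_comp_extChartAt_symm {Y : Type*} [NormedAddCommGroup Y] [NormedSpace ℝ Y]
    {G : X → Y} (hy : y ∈ (extChartAt (𝓡 m) x).target)
    (hG : MDifferentiableAt (𝓡 m) 𝓘(ℝ, Y) G ((extChartAt (𝓡 m) x).symm y))
    (u : EuclideanSpace ℝ (Fin m)) :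
    dirDeriv u (G ∘ (extChartAt (𝓡 m) x).symm) y
      = mvfderiv (𝓡 m) G ((extChartAt (𝓡 m) x).symm y) (chartFrame x y u) := by
  have h := mfderiv_comp_apply y hG (mdifferentiableAt_extChartAt_symm_of_mem x hy) u
  rw [mfderiv_eq_fderiv] at h
  exact h

/-- The chart frame spans the tangent space at `e.symm (e x)`, which is the one at `x` only up to a
propositional equality. The identity is therefore proved there for all tangent vectors, and the base
point is rewritten at the end. -/
theorem isometric_of_extChartAt {N : ℕ} (g : RiemMetric m X) {G : X → Minkowski N}
    (hG : MDifferentiableAt (𝓡 m) 𝓘(ℝ, Minkowski N) G x)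
    (h : ∀ u v, lorentz (dirDeriv u (G ∘ (extChartAt (𝓡 m) x).symm) (extChartAt (𝓡 m) x x))
        (dirDeriv v (G ∘ (extChartAt (𝓡 m) x).symm) (extChartAt (𝓡 m) x x))
      = g.inner _ (chartFrame x (extChartAt (𝓡 m) x x) u) (chartFrame x (extChartAt (𝓡 m) x x) v))
    (u v : TangentSpace (𝓡 m) x) :
    lorentz (mvfderiv (𝓡 m) G x u) (mvfderiv (𝓡 m) G x v) = g.inner x u v := by
  have hx := extChartAt_to_inv (I := 𝓡 m) x
  have key : ∀ u v : TangentSpace (𝓡 m) ((extChartAt (𝓡 m) x).symm (extChartAt (𝓡 m) x x)),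
      lorentz (mvfderiv (𝓡 m) G _ u) (mvfderiv (𝓡 m) G _ v) = g.inner _ u v := by
    intro u v
    have hs := (bijective_chartFrame x (mem_extChartAt_target (I := 𝓡 m) x)).2
    obtain ⟨u, rfl⟩ := hs u
    obtain ⟨v, rfl⟩ := hs v
    rw [← h u v, dirDeriv_comp_extChartAt_symm x (mem_extChartAt_target x) (by rwa [hx]),
      dirDeriv_comp_extChartAt_symm x (mem_extChartAt_target x) (by rwa [hx])]
  rw [hx] at key
  exact key u v

end

/-- This turns `productMetric`, read in a chart, into a sum of forms each of which depends on the
coordinates of its own factor only. -/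
theorem mfderiv_proj_mfderiv_symm (p : ∀ i, M i) {x : ∀ i, EuclideanSpace ℝ (Fin (n i))}
    (hx : x ∈ (extChartAt (prodModel n) p).target) (i : Fin k)
    (u : ∀ i, EuclideanSpace ℝ (Fin (n i))) :
    mfderiv (prodModel n) (𝓡 (n i)) (fun q : ∀ j, M j => q i) ((extChartAt (prodModel n) p).symm x)
      (mfderiv 𝓘(ℝ, ∀ i, EuclideanSpace ℝ (Fin (n i))) (prodModel n)
        (extChartAt (prodModel n) p).symm x u) = chartFrame (p i) (x i) (u i) := by
  have := IsManifold.pi (fun i => 𝓡 (n i)) ∞ M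
  have h1 : MDifferentiableAt 𝓘(ℝ, ∀ i, EuclideanSpace ℝ (Fin (n i))) (prodModel n)
      (extChartAt (prodModel n) p).symm x :=
    ((contMDiffOn_extChartAt_symm (n := ∞) p).contMDiffAt
      ((isOpen_extChartAt_prodModel_target p).mem_nhds hx)).mdifferentiableAt (by simp)
  have h2 := (contMDiff_proj_prodModel (n := n) (M := M) i).mdifferentiableAt (by simp)
    (x := (extChartAt (prodModel n) p).symm x)
  refine (mfderiv_comp_apply x h2 h1 u).symm.trans ?_
  have hx' := hx
  rw [extChartAt_prodModel] at hx'
  have h3 : MDifferentiableAt 𝓘(ℝ, ∀ i, EuclideanSpace ℝ (Fin (n i)))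
      𝓘(ℝ, EuclideanSpace ℝ (Fin (n i)))
      (fun y : ∀ i, EuclideanSpace ℝ (Fin (n i)) => y i) x :=
    (ContinuousLinearMap.proj (R := ℝ) (φ := fun i => EuclideanSpace ℝ (Fin (n i)))
        i).mdifferentiableAt
  have h4 := mdifferentiableAt_extChartAt_symm_of_mem (p i) (hx' i trivial)
  have h5 : (fun q : ∀ j, M j => q i) ∘ (extChartAt (prodModel n) p).symm =
    (extChartAt (𝓡 (n i)) (p i)).symm ∘ (fun y => y i) := by
    rw [extChartAt_prodModel]; rfl
  rw [h5]
  refine (mfderiv_comp_apply x h4 h3 u).trans ?_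
  have h6 : mfderiv 𝓘(ℝ, ∀ i, EuclideanSpace ℝ (Fin (n i)))
      𝓘(ℝ, EuclideanSpace ℝ (Fin (n i)))
      (fun y : ∀ i, EuclideanSpace ℝ (Fin (n i)) => y i) x =
      (ContinuousLinearMap.proj (R := ℝ) (φ := fun i => EuclideanSpace ℝ (Fin (n i))) i) :=
    (ContinuousLinearMap.proj (R := ℝ) (φ := fun i => EuclideanSpace ℝ (Fin (n i))) i).mfderiv_eq
  exact congrArg (chartFrame (p i) (x i)) (congrArg (fun L => L u) h6)
end

/-! ### Linear algebra of the Lorentz product and of light cone triples. -/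

noncomputable section

/-- A positive definite symmetric bilinear form on a vector space of dimension `N` is, in a suitable
linear frame, the inner product of `ℝ^N`. -/
theorem exists_orthonormal_frame {V : Type*} [AddCommGroup V] [Module ℝ V] [FiniteDimensional ℝ V]
    {N : ℕ} (hV : Module.finrank ℝ V = N) (B : V →ₗ[ℝ] V →ₗ[ℝ] ℝ) (hs : ∀ x y, B x y = B y x)
    (hp : ∀ x, x ≠ 0 → 0 < B x x) :
    ∃ e : EuclideanSpace ℝ (Fin N) ≃ₗ[ℝ] V, ∀ x y, B (e x) (e y) = inner ℝ x y := by
  let core : InnerProductSpace.Core ℝ V :=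
    { inner := fun x y => B x y
      conj_inner_symm := fun x y => by simpa using hs y x
      re_inner_nonneg := fun x => by
        rcases eq_or_ne x 0 with rfl | h
        · simp
        · simpa using (hp x h).le
      add_left := fun x y z => by simp
      smul_left := fun x y r => by simp
      definite := fun x hx => by
        by_contra h
        exact (hp x h).ne' hx }
  let : NormedAddCommGroup V := core.toNormedAddCommGroup
  let : InnerProductSpace ℝ V := InnerProductSpace.ofCore core.toCore
  let b := (stdOrthonormalBasis ℝ V).reindex (finCongr hV)
  exact ⟨b.repr.symm.toLinearEquiv, fun x y => b.repr.symm.inner_map_map x y⟩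

/-- The Lorentz product as a continuous bilinear map. -/
def lorentzL (m : ℕ) : Minkowski m →L[ℝ] Minkowski m →L[ℝ] ℝ :=
  LinearMap.toContinuousBilinearMap (LinearMap.mk₂ ℝ lorentz lorentz_add_left lorentz_smul_left
    lorentz_add_right lorentz_smul_right)

@[simp] theorem lorentzL_apply {m : ℕ} (x y : Minkowski m) : lorentzL m x y = lorentz x y := rfl

@[simp] theorem lorentz_zero_left {m : ℕ} (y : Minkowski m) : lorentz 0 y = 0 := by
  simp [← lorentzL_apply]

@[simp] theorem lorentz_zero_right {m : ℕ} (y : Minkowski m) : lorentz y 0 = 0 := by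
  simp [← lorentzL_apply]

theorem lorentz_sub_left {m : ℕ} (x y z : Minkowski m) :
    lorentz (x - y) z = lorentz x z - lorentz y z := by
  simp [← lorentzL_apply]

theorem lorentz_sub_right {m : ℕ} (x y z : Minkowski m) :
    lorentz x (y - z) = lorentz x y - lorentz x z := by
  simp [← lorentzL_apply]

theorem lorentz_sum_left {m : ℕ} {ι : Type*} (s : Finset ι) (x : ι → Minkowski m)
    (y : Minkowski m) : lorentz (∑ i ∈ s, x i) y = ∑ i ∈ s, lorentz (x i) y := by
  simp [← lorentzL_apply, map_sum]

theorem lorentz_sum_right {m : ℕ} {ι : Type*} (s : Finset ι) (x : ι → Minkowski m)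
    (y : Minkowski m) : lorentz y (∑ i ∈ s, x i) = ∑ i ∈ s, lorentz y (x i) := by
  simp [← lorentzL_apply, map_sum]

/-- Reversal of the last coordinate. -/
def timeReversal {m : ℕ} (x : Minkowski m) : Minkowski m :=
  WithLp.toLp 2 (Fin.snoc (fun i : Fin m => x i.castSucc) (-x (Fin.last m)))

/-- Non-degeneracy of the Lorentz product in usable form: pairing with the time reversal recovers
the positive definite inner product. -/
theorem lorentz_timeReversal {m : ℕ} (x y : Minkowski m) :
    lorentz (timeReversal x) y = inner ℝ x y := by
  simp [lorentz, timeReversal, PiLp.inner_apply, Fin.sum_univ_castSucc, mul_comm]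

/-- A light-like vector and a linear isometry of `ℝ^N` into its orthogonal complement extend to a
light cone triple. -/
theorem LightConeTriple.exists_extension {N : ℕ} {o : Minkowski (N + 1)} (ho : o ≠ 0)
    (hoo : lorentz o o = 0) (A : EuclideanSpace ℝ (Fin N) →ₗ[ℝ] Minkowski (N + 1))
    (hA : ∀ x y, lorentz (A x) (A y) = inner ℝ x y) (hAo : ∀ x, lorentz (A x) o = 0) :
    ∃ T : LightConeTriple N, T.p₀ = o ∧ T.A = A := by
  -- The time reversal of `o` is not orthogonal to `o`; subtracting its component `A z` makes it
  -- orthogonal to the range of `A` without changing its product with `o`.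
  set z : EuclideanSpace ℝ (Fin N) :=
    WithLp.toLp 2 fun j => lorentz (timeReversal o) (A (EuclideanSpace.single j 1)) with hz
  have hzA : ∀ x, lorentz (timeReversal o) (A x) = inner ℝ z x := fun x => by
    conv_lhs => rw [← (EuclideanSpace.basisFun (Fin N) ℝ).sum_repr x]
    simp [map_sum, lorentz_sum_right, lorentz_smul_right, hz, PiLp.inner_apply]
  set y := timeReversal o - A z with hy
  have hyo : lorentz y o = ‖o‖ ^ 2 := by
    rw [hy, lorentz_sub_left, hAo, lorentz_timeReversal, real_inner_self_eq_norm_sq, sub_zero]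
  have hyA : ∀ x, lorentz y (A x) = 0 := fun x => by
    rw [hy, lorentz_sub_left, hzA, hA, sub_self]
  have hn : ‖o‖ ^ 2 ≠ 0 := by simpa using ho
  -- The vector `w = a • y - b • o` satisfies `⟨w, o⟩ = 1` by the choice of `a`, and `⟨w, w⟩ = a²
  -- ⟨y, y⟩ - 2 b = 0` by the choice of `b`.
  set a := (‖o‖ ^ 2)⁻¹ with ha
  set b := a ^ 2 * lorentz y y / 2 with hb
  have haa : a * ‖o‖ ^ 2 = 1 := inv_mul_cancel₀ hn
  refine ⟨⟨o, a • y - b • o, A, ?_, hoo, ?_, hA, hAo, ?_⟩, rfl, rfl⟩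
  · simp only [lorentz_sub_left, lorentz_sub_right, lorentz_smul_left, lorentz_smul_right, hoo, hyo,
      lorentz_comm o y, hb]
    linear_combination (-(a ^ 2 * lorentz y y)) * haa
  · rw [lorentz_sub_right, lorentz_smul_right, lorentz_smul_right, lorentz_comm, hyo, hoo, haa]
    ring
  · intro x
    rw [lorentz_sub_right, lorentz_smul_right, lorentz_smul_right, hAo, lorentz_comm, hyA]
    ring

/-- The standard light cone triple. -/
def LightConeTriple.std (N : ℕ) : LightConeTriple N where
  p₀ := WithLp.toLp 2 (Fin.snoc (Fin.snoc (fun _ => 0) (1 / 2)) (-1 / 2))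
  w := WithLp.toLp 2 (Fin.snoc (Fin.snoc (fun _ => 0) 1) 1)
  A :=
    { toFun := fun x => WithLp.toLp 2 (Fin.snoc (Fin.snoc (fun i => x i) 0) 0)
      map_add' := fun x y => by
        ext i
        refine Fin.lastCases (by simp) (fun i => Fin.lastCases (by simp) (fun i => by simp) i) i
      map_smul' := fun r x => by
        ext i
        refine Fin.lastCases (by simp) (fun i => Fin.lastCases (by simp) (fun i => by simp) i) i }
  lorentz_w_w := by simp [lorentz, Fin.sum_univ_castSucc]
  lorentz_p₀_p₀ := by simp [lorentz, Fin.sum_univ_castSucc]; norm_num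
  lorentz_p₀_w := by simp [lorentz, Fin.sum_univ_castSucc]; norm_num
  lorentz_A := fun x y => by simp [lorentz, Fin.sum_univ_castSucc, PiLp.inner_apply, mul_comm]
  lorentz_A_p₀ := fun x => by simp [lorentz, Fin.sum_univ_castSucc]
  lorentz_A_w := fun x => by simp [lorentz, Fin.sum_univ_castSucc]

namespace LightConeTriple
variable {N : ℕ} (T : LightConeTriple N)

theorem lorentz_w_p₀ : lorentz T.w T.p₀ = 1 := by rw [lorentz_comm, T.lorentz_p₀_w]
theorem lorentz_p₀_A (x : EuclideanSpace ℝ (Fin N)) : lorentz T.p₀ (T.A x) = 0 := by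
  rw [lorentz_comm, T.lorentz_A_p₀]
theorem lorentz_w_A (x : EuclideanSpace ℝ (Fin N)) : lorentz T.w (T.A x) = 0 := by
  rw [lorentz_comm, T.lorentz_A_w]

theorem lorentz_embed_w (x : EuclideanSpace ℝ (Fin N)) : lorentz (T.embed x) T.w = 1 := by
  simp [embed, lorentz_sub_left, lorentz_add_left, lorentz_smul_left, T.lorentz_w_w,
    T.lorentz_p₀_w, T.lorentz_A_w]

theorem lorentz_embed_A (x y : EuclideanSpace ℝ (Fin N)) :
    lorentz (T.embed x) (T.A y) = inner ℝ x y := by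
  simp [embed, lorentz_sub_left, lorentz_add_left, lorentz_smul_left, T.lorentz_w_A,
    T.lorentz_p₀_A, T.lorentz_A]

theorem lorentz_embed_embed (x y : EuclideanSpace ℝ (Fin N)) :
    lorentz (T.embed x) (T.embed y) = -(1 / 2) * ‖x - y‖ ^ 2 := by
  simp only [embed, lorentz_sub_left, lorentz_add_left, lorentz_smul_left, T.lorentz_w_A,
    T.lorentz_p₀_A, T.lorentz_A, lorentz_sub_right, lorentz_add_right, lorentz_smul_right,
    T.lorentz_w_w, T.lorentz_p₀_p₀, T.lorentz_p₀_w, T.lorentz_w_p₀, T.lorentz_A_w, T.lorentz_A_p₀,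
    norm_sub_sq_real]
  ring

theorem lorentz_embed_self (x : EuclideanSpace ℝ (Fin N)) :
    lorentz (T.embed x) (T.embed x) = 0 := by
  simp [lorentz_embed_embed]

/-- `toEuclidean` is homogeneous of degree zero, so it sees only the ray of a light-like vector. A
conformal map is thus recovered from its lift whatever the conformal factor. -/
theorem toEuclidean_smul_embed {r : ℝ} (hr : r ≠ 0) (x : EuclideanSpace ℝ (Fin N)) :
    T.toEuclidean (r • T.embed x) = x := by
  ext j
  simp [toEuclidean, lorentz_smul_left, lorentz_embed_w, lorentz_embed_A, hr,
    EuclideanSpace.inner_single_right]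

theorem eq_smul_of_orthogonal {z : Minkowski (N + 1)} (hz : lorentz z T.p₀ = 0)
    (hA : ∀ x, lorentz z (T.A x) = 0) : z = lorentz z T.w • T.p₀ := by
  obtain ⟨a, b, x, rfl⟩ := T.exists_decomp z
  have hb : b = 0 := by
    simpa [lorentz_add_left, lorentz_smul_left, T.lorentz_p₀_p₀, T.lorentz_w_p₀, T.lorentz_A_p₀]
      using hz
  have hx : x = 0 := by
    simpa [lorentz_add_left, lorentz_smul_left, T.lorentz_p₀_A, T.lorentz_w_A, T.lorentz_A]
      using hA x
  simp [hb, hx, lorentz_smul_left, T.lorentz_p₀_w]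

end LightConeTriple
end

/-! ### Vanishing of the mixed second derivatives. -/

noncomputable section

section dirDeriv
variable {X Y : Type*} [NormedAddCommGroup X] [NormedSpace ℝ X] [NormedAddCommGroup Y]
    [NormedSpace ℝ Y] {U : Set X} {x : X} {G : X → Y}

theorem ContDiffOn.contDiffOn_dirDeriv (hG : ContDiffOn ℝ ∞ G U) (hU : IsOpen U) (a : X) :
    ContDiffOn ℝ ∞ (dirDeriv a G) U :=
  (hG.fderiv_of_isOpen hU (m := ∞) (by simp)).clm_apply contDiffOn_const

theorem ContDiffOn.differentiableAt_of_isOpen (hG : ContDiffOn ℝ ∞ G U) (hU : IsOpen U)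
    (hx : x ∈ U) : DifferentiableAt ℝ G x :=
  (hG.contDiffAt (hU.mem_nhds hx)).differentiableAt (by simp)

theorem dirDeriv_comm (hG : ContDiffOn ℝ ∞ G U) (hU : IsOpen U) (hx : x ∈ U) (a b : X) :
    dirDeriv a (dirDeriv b G) x = dirDeriv b (dirDeriv a G) x := by
  have h1 : DifferentiableAt ℝ (fderiv ℝ G) x :=
    (hG.fderiv_of_isOpen hU (m := ∞) (by simp)).differentiableAt_of_isOpen hU hx
  have h2 : ∀ a b, dirDeriv a (dirDeriv b G) x = fderiv ℝ (fderiv ℝ G) x a b := fun a b => by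
    unfold dirDeriv
    rw [fderiv_clm_apply h1 (differentiableAt_const b)]
    simp
  rw [h2, h2]
  exact ((hG.contDiffAt (hU.mem_nhds hx)).isSymmSndFDerivAt
    (by simp only [minSmoothness_of_isRCLikeNormedField]; exact ENat.LEInfty.out)).eq a b

theorem dirDeriv_congr {G' : X → Y} (hU : IsOpen U) (hx : x ∈ U) (h : ∀ y ∈ U, G y = G' y) (a : X) :
    dirDeriv a G x = dirDeriv a G' x := by
  unfold dirDeriv
  rw [Filter.EventuallyEq.fderiv_eq (Filter.eventually_of_mem (hU.mem_nhds hx) h)]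

/-- No regularity of the metric coefficients is assumed below; that they are constant along lines in
another factor is all that gets differentiated. -/
theorem dirDeriv_eq_zero_of_line (hG : DifferentiableAt ℝ G x) (a : X)
    (h : ∀ᶠ t in nhds (0 : ℝ), G (x + t • a) = G x) : dirDeriv a G x = 0 := by
  have h1 : HasDerivAt (fun t : ℝ => G (x + t • a)) (fderiv ℝ G x a) 0 :=
    hG.hasFDerivAt.hasLineDerivAt a
  exact h1.unique ((hasDerivAt_const (0 : ℝ) (G x)).congr_of_eventuallyEq h)

theorem dirDeriv_lorentz {m : ℕ} {G H : X → Minkowski m} (hG : DifferentiableAt ℝ G x)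
    (hH : DifferentiableAt ℝ H x) (a : X) :
    dirDeriv a (fun y => lorentz (G y) (H y)) x
      = lorentz (dirDeriv a G x) (H x) + lorentz (G x) (dirDeriv a H x) := by
  have h := ((lorentzL m).hasFDerivAt.comp x hG.hasFDerivAt).clm_apply hH.hasFDerivAt
  change fderiv ℝ (fun y => (lorentzL m ∘ G) y (H y)) x a = _
  rw [h.fderiv]
  simp [dirDeriv, add_comm]

theorem ContDiffOn.lorentz {m : ℕ} {G H : X → Minkowski m} (hG : ContDiffOn ℝ ∞ G U)
    (hH : ContDiffOn ℝ ∞ H U) : ContDiffOn ℝ ∞ (fun y => lorentz (G y) (H y)) U :=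
  ((lorentzL m).contDiff.comp_contDiffOn hG).clm_apply hH

theorem dirDeriv_smul {r : X → ℝ} (hr : DifferentiableAt ℝ r x) (hG : DifferentiableAt ℝ G x)
    (a : X) : dirDeriv a (fun y => r y • G y) x = dirDeriv a r x • G x + r x • dirDeriv a G x := by
  unfold dirDeriv
  rw [fderiv_fun_smul hr hG]
  simp [add_comm]

theorem eq_of_dirDeriv_eq_zero {a : X} (hG : ∀ t ∈ Set.Icc (0 : ℝ) 1, DifferentiableAt ℝ G (x + t •
    a))
    (h : ∀ t ∈ Set.Icc (0 : ℝ) 1, dirDeriv a G (x + t • a) = 0) : G (x + a) = G x := by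
  have key := (convex_Icc (0 : ℝ) 1).norm_image_sub_le_of_norm_hasDerivWithin_le
    (f := fun t : ℝ => G (x + t • a)) (f' := fun _ => 0) (C := 0) (x := 0) (y := 1) ?_ (by simp)
    (by simp) (by simp)
  · simpa [sub_eq_zero] using key
  · intro t ht
    have h1 : HasDerivAt (fun s : ℝ => x + s • a) a t := by
      simpa using ((hasDerivAt_id t).smul_const a).const_add x
    have h2 := (hG t ht).hasFDerivAt.comp_hasDerivAt t h1
    have h3 := h t ht
    rw [dirDeriv] at h3
    rw [h3] at h2
    exact h2.hasDerivWithinAt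

end dirDeriv

section isometric
variable {k : ℕ} {n : Fin k → ℕ} {N : ℕ}

/-- A vector which is orthogonal to a light-like immersion of a Riemannian product and to its
derivatives is proportional to the position vector. -/
theorem exists_smul_of_orthogonal (hN : ∑ i, n i = N)
    {D : (∀ i, EuclideanSpace ℝ (Fin (n i))) → Minkowski (N + 1)} (hD : IsLinearMap ℝ D)
    {o : Minkowski (N + 1)}
    (ho : o ≠ 0) (hoo : lorentz o o = 0) (hDo : ∀ u, lorentz (D u) o = 0)
    (hpos : ∀ u, u ≠ 0 → 0 < lorentz (D u) (D u)) {z : Minkowski (N + 1)}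
    (hzo : lorentz z o = 0) (hzD : ∀ u, lorentz z (D u) = 0) : ∃ β : ℝ, z = β • o := by
  -- The form `⟨D u, D v⟩` is positive definite in dimension `N`. An orthonormal frame of it,
  -- together with `o`, extends to a light cone triple, in which the orthogonal complement of `o`
  -- and of the frame is the line of `o`.
  obtain ⟨e, he⟩ := exists_orthonormal_frame (V := ∀ i, EuclideanSpace ℝ (Fin (n i))) (N := N)
    (by simp [Module.finrank_pi_fintype, hN])
    ((LinearMap.mk₂ ℝ lorentz lorentz_add_left lorentz_smul_left lorentz_add_right
      lorentz_smul_right).compl₁₂ (hD.mk' D) (hD.mk' D)) (fun x y => lorentz_comm _ _) hpos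
  obtain ⟨T, rfl, hA⟩ := LightConeTriple.exists_extension ho hoo (hD.mk' D ∘ₗ e.toLinearMap) he
    (fun x => hDo _)
  exact ⟨_, T.eq_smul_of_orthogonal hzo (fun x => by rw [hA]; exact hzD _)⟩

variable {U : Set (∀ i, EuclideanSpace ℝ (Fin (n i)))}
  {F : (∀ i, EuclideanSpace ℝ (Fin (n i))) → Minkowski (N + 1)}
  {h : ∀ i, EuclideanSpace ℝ (Fin (n i)) →
      EuclideanSpace ℝ (Fin (n i)) →L[ℝ] EuclideanSpace ℝ (Fin (n i)) →L[ℝ] ℝ}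

/-- The Christoffel symbols of a product metric with mixed indices vanish. -/
theorem lorentz_dirDeriv_dirDeriv_mixed (hU : IsOpen U) (hF : ContDiffOn ℝ ∞ F U)
    (hiso : ∀ x ∈ U, ∀ u v, lorentz (dirDeriv u F x) (dirDeriv v F x) = ∑ i, h i (x i) (u i) (v i))
    {i j : Fin k} (hij : i ≠ j) (u : EuclideanSpace ℝ (Fin (n i)))
    (v : EuclideanSpace ℝ (Fin (n j))) (z : ∀ i, EuclideanSpace ℝ (Fin (n i)))
    {x : ∀ i, EuclideanSpace ℝ (Fin (n i))} (hx : x ∈ U) :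
    lorentz (dirDeriv (Pi.single i u) (dirDeriv (Pi.single j v) F) x) (dirDeriv z F x) = 0 := by
  have hd : ∀ a, DifferentiableAt ℝ (dirDeriv a F) x := fun a =>
    (hF.contDiffOn_dirDeriv hU a).differentiableAt_of_isOpen hU hx
  have hprod : ∀ (l : Fin k) (b : EuclideanSpace ℝ (Fin (n l))) z, ∀ y ∈ U,
      lorentz (dirDeriv (Pi.single l b) F y) (dirDeriv z F y) = h l (y l) b (z l) := by
    intro l b z y hy
    rw [hiso y hy, Finset.sum_eq_single l]
    · simp
    · intro m _ hm
      simp [Pi.single_eq_of_ne hm]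
    · simp
  -- The product `⟨∂_b F, ∂_z F⟩` depends on the `m`-th coordinates only, so its derivative along
  -- the factor `l` is zero.
  have hline : ∀ {l m : Fin k} (_ : l ≠ m) (a : EuclideanSpace ℝ (Fin (n l)))
      (b : EuclideanSpace ℝ (Fin (n m))) (z : ∀ i, EuclideanSpace ℝ (Fin (n i))),
      lorentz (dirDeriv (Pi.single l a) (dirDeriv (Pi.single m b) F) x) (dirDeriv z F x)
      + lorentz (dirDeriv (Pi.single m b) F x) (dirDeriv (Pi.single l a) (dirDeriv z F) x) = 0 := by
    intro l m hlm a b z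
    rw [← dirDeriv_lorentz (hd _) (hd _)]
    refine dirDeriv_eq_zero_of_line (((hF.contDiffOn_dirDeriv hU _).lorentz
      (hF.contDiffOn_dirDeriv hU _)).differentiableAt_of_isOpen hU hx) _ ?_
    have hc : Filter.Tendsto (fun t : ℝ => x + t • (Pi.single l a : ∀ i, EuclideanSpace ℝ (Fin (n
        i))))
        (nhds 0) (nhds x) := by
      have : Continuous fun t : ℝ => x + t • (Pi.single l a : ∀ i, EuclideanSpace ℝ (Fin (n i)))
          := by
        fun_prop
      simpa using this.tendsto 0
    filter_upwards [hc.eventually (hU.mem_nhds hx)] with t ht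
    rw [hprod m b z _ ht, hprod m b z _ hx]
    simp [Pi.single_eq_of_ne hlm.symm]
  -- Different factors are orthogonal; differentiate this along `z`. As in the Koszul formula, the
  -- two instances of `hline` minus this identity leave twice the desired product.
  have hzero : lorentz (dirDeriv z (dirDeriv (Pi.single i u) F) x) (dirDeriv (Pi.single j v) F x)
      + lorentz (dirDeriv (Pi.single i u) F x) (dirDeriv z (dirDeriv (Pi.single j v) F) x) = 0 := by
    rw [← dirDeriv_lorentz (hd _) (hd _), dirDeriv_congr (G' := fun _ => (0 : ℝ)) hU hx]
    · simp [dirDeriv]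
    · intro y hy
      rw [hprod i u _ y hy, Pi.single_eq_of_ne hij, map_zero]
  have e1 := hline hij u v z
  have e2 := hline hij.symm v u z
  rw [dirDeriv_comm hF hU hx z, dirDeriv_comm hF hU hx z] at hzero
  rw [dirDeriv_comm hF hU hx (Pi.single j v) (Pi.single i u)] at e2
  have c1 := lorentz_comm (dirDeriv (Pi.single j v) F x) (dirDeriv (Pi.single i u) (dirDeriv z F) x)
  linarith

/-- An isometric immersion of a Riemannian product of total dimension `N ≥ 3` into the light cone of
`𝕃^(N+2)` has vanishing mixed second derivatives. -/
theorem dirDeriv_dirDeriv_mixed_eq_zero (hn : ∀ i, 1 ≤ n i) (hN : ∑ i, n i = N) (hN3 : 3 ≤ N)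
    (hU : IsOpen U) (hF : ContDiffOn ℝ ∞ F U) (hFF : ∀ x ∈ U, lorentz (F x) (F x) = 0)
    {w : Minkowski (N + 1)} (hw : ∀ x ∈ U, lorentz (F x) w ≠ 0)
    (hpos : ∀ x ∈ U, ∀ i v, v ≠ 0 → 0 < h i (x i) v v)
    (hiso : ∀ x ∈ U, ∀ u v, lorentz (dirDeriv u F x) (dirDeriv v F x) = ∑ i, h i (x i) (u i) (v i))
    {i j : Fin k} (hij : i ≠ j) (u : EuclideanSpace ℝ (Fin (n i)))
    (v : EuclideanSpace ℝ (Fin (n j))) {x : ∀ i, EuclideanSpace ℝ (Fin (n i))} (hx : x ∈ U) :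
    dirDeriv (Pi.single i u) (dirDeriv (Pi.single j v) F) x = 0 := by
  have hd : ∀ a, ∀ x ∈ U, DifferentiableAt ℝ (dirDeriv a F) x := fun a x hx =>
    (hF.contDiffOn_dirDeriv hU a).differentiableAt_of_isOpen hU hx
  have hdF : ∀ x ∈ U, DifferentiableAt ℝ F x := fun x hx => hF.differentiableAt_of_isOpen hU hx
  have hFd : ∀ a, ∀ x ∈ U, lorentz (dirDeriv a F x) (F x) = 0 := by
    intro a x hx
    have h1 := dirDeriv_lorentz (hdF x hx) (hdF x hx) a
    rw [dirDeriv_congr (G' := fun _ => (0 : ℝ)) hU hx hFF, lorentz_comm (F x)] at h1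
    simp only [dirDeriv, fderiv_fun_const, Pi.zero_apply, zero_apply] at h1
    rw [dirDeriv]
    linarith
  have hquad : ∀ x ∈ U, ∀ a : ∀ i, EuclideanSpace ℝ (Fin (n i)), a ≠ 0 →
      0 < lorentz (dirDeriv a F x) (dirDeriv a F x) := by
    intro x hx a ha
    rw [hiso x hx]
    obtain ⟨l, hl⟩ := Function.ne_iff.1 ha
    refine Finset.sum_pos' (fun m _ => ?_) ⟨l, Finset.mem_univ l, hpos x hx l _ hl⟩
    rcases eq_or_ne (a m) 0 with h0 | h0
    · simp [h0]
    · exact (hpos x hx m _ h0).le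
  -- Pairing with `w` identifies the factor of proportionality `β` as a quotient, which makes it
  -- visibly differentiable in `key`.
  have hmul : ∀ {l m : Fin k} (_ : l ≠ m) (a : EuclideanSpace ℝ (Fin (n l)))
      (b : EuclideanSpace ℝ (Fin (n m))), ∀ x ∈ U,
      dirDeriv (Pi.single l a) (dirDeriv (Pi.single m b) F) x =
      (lorentz (dirDeriv (Pi.single l a) (dirDeriv (Pi.single m b) F) x) w / lorentz (F x) w)
        • F x := by
    intro l m hlm a b x hx
    have h0 : ∀ z, lorentz (dirDeriv (Pi.single l a) (dirDeriv (Pi.single m b) F) x)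
        (dirDeriv z F x) = 0 :=
      fun z => lorentz_dirDeriv_dirDeriv_mixed (h := h) hU hF hiso hlm a b z hx
    set z := dirDeriv (Pi.single l a) (dirDeriv (Pi.single m b) F) x with hz
    have hz0 : lorentz z (F x) = 0 := by
      have h1 := dirDeriv_lorentz (hd (Pi.single m b) x hx) (hdF x hx) (Pi.single l a)
      rw [dirDeriv_congr (G' := fun _ => (0 : ℝ)) hU hx (hFd _)] at h1
      have h2 : lorentz (dirDeriv (Pi.single m b) F x) (dirDeriv (Pi.single l a) F x) = 0 := by
        rw [hiso x hx]
        refine Finset.sum_eq_zero fun p _ => ?_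
        rcases eq_or_ne p l with rfl | hp
        · simp [Pi.single_eq_of_ne hlm]
        · simp [Pi.single_eq_of_ne hp]
      have h3 : dirDeriv (Pi.single l a) (fun _ => (0 : ℝ)) x = 0 := by simp [dirDeriv]
      rw [h2, h3] at h1
      linarith
    obtain ⟨β, hβ⟩ := exists_smul_of_orthogonal hN (D := fun a => dirDeriv a F x)
      (fderiv ℝ F x).toLinearMap.isLinear (o := F x)
      (fun h0 => hw x hx (by simp [h0])) (hFF x hx) (fun a => hFd a x hx) (hquad x hx)
      (z := z) hz0 h0
    rw [hβ, lorentz_smul_left, mul_div_cancel_right₀ _ (hw x hx)]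
  -- Compare `∂_c (β(a, b) F)` with `∂ₐ (β(c, b) F)` and pair with `∂_c F`. The terms containing `F`
  -- drop out, which leaves `β(a, b) ‖c‖² = β(c, b) ⟨a, c⟩ = 0`.
  have key : ∀ {l m p : Fin k} (_ : l ≠ m) (_ : p ≠ m) (a : EuclideanSpace ℝ (Fin (n l)))
      (b : EuclideanSpace ℝ (Fin (n m))) (c : EuclideanSpace ℝ (Fin (n p))), c ≠ 0 →
      ∑ q, h q (x q) ((Pi.single l a : ∀ i, EuclideanSpace ℝ (Fin (n i))) q)
        ((Pi.single p c : ∀ i, EuclideanSpace ℝ (Fin (n i))) q) = 0 →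
      dirDeriv (Pi.single l a) (dirDeriv (Pi.single m b) F) x = 0 := by
    intro l m p hlm hpm a b c hc horth
    have hcoef : ∀ {l m : Fin k} (a : EuclideanSpace ℝ (Fin (n l)))
        (b : EuclideanSpace ℝ (Fin (n m))), DifferentiableAt ℝ (fun y =>
          lorentz (dirDeriv (Pi.single l a) (dirDeriv (Pi.single m b) F) y) w / lorentz (F y)
              w) x := by
      intro l m a b
      have e1 : DifferentiableAt ℝ
          (fun y => lorentz (dirDeriv (Pi.single l a) (dirDeriv (Pi.single m b) F) y) w) x :=
        (((hF.contDiffOn_dirDeriv hU _).contDiffOn_dirDeriv hU _).lorentz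
          contDiffOn_const).differentiableAt_of_isOpen hU hx
      have e2 : DifferentiableAt ℝ (fun y => lorentz (F y) w) x :=
        (hF.lorentz contDiffOn_const).differentiableAt_of_isOpen hU hx
      have e3 : DifferentiableAt ℝ (fun y => (lorentz (F y) w)⁻¹) x := e2.fun_inv (hw x hx)
      simpa only [div_eq_mul_inv] using e1.fun_mul e3
    have h3 := dirDeriv_comm (hF.contDiffOn_dirDeriv hU (Pi.single m b)) hU hx
      (Pi.single p c) (Pi.single l a)
    rw [dirDeriv_congr hU hx (hmul hlm a b), dirDeriv_congr hU hx (hmul hpm c b),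
      dirDeriv_smul (hcoef a b) (hdF x hx), dirDeriv_smul (hcoef c b) (hdF x hx)] at h3
    have h4 := congrArg (fun y => lorentz y (dirDeriv (Pi.single p c) F x)) h3
    simp only [lorentz_add_left, lorentz_smul_left, lorentz_comm (F x) (dirDeriv _ F x), hFd _ x
        hx] at h4
    rw [hiso x hx (Pi.single l a), horth] at h4
    have h5 := hquad x hx (Pi.single p c) (by simpa using hc)
    rw [hmul hlm a b x hx]
    have h6 : lorentz (dirDeriv (Pi.single l a) (dirDeriv (Pi.single m b) F) x) w
        / lorentz (F x) w = 0 := by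
      simpa [h5.ne'] using h4
    rw [h6, zero_smul]
  have hdim : ∀ (l : Fin k) (a : EuclideanSpace ℝ (Fin (n l))), 2 ≤ n l →
      ∃ c, c ≠ 0 ∧ h l (x l) a c = 0 := by
    intro l a hl
    obtain ⟨c, hc, hc0⟩ := (Submodule.ne_bot_iff _).1
      (LinearMap.ker_ne_bot_of_finrank_lt (f := (h l (x l) a).toLinearMap)
        (by rw [Module.finrank_self, finrank_euclideanSpace_fin]; omega))
    exact ⟨c, hc0, hc⟩
  -- A third factor supplies a vector orthogonal to `u`. With two factors only, `n i + n j ≥ 3`, so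
  -- one of them has room for an orthogonal vector, and symmetry of the second derivative allows
  -- either choice.
  by_cases hex : ∃ p, p ≠ i ∧ p ≠ j
  · obtain ⟨p, hpi, hpj⟩ := hex
    have : Nontrivial (EuclideanSpace ℝ (Fin (n p))) := by
      have : Nonempty (Fin (n p)) := ⟨⟨0, hn p⟩⟩
      infer_instance
    obtain ⟨c, hc⟩ := exists_ne (0 : EuclideanSpace ℝ (Fin (n p)))
    refine key hij hpj u v c hc (Finset.sum_eq_zero fun q _ => ?_)
    rcases eq_or_ne q p with rfl | hq
    · simp [Pi.single_eq_of_ne hpi]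
    · simp [Pi.single_eq_of_ne hq]
  · push Not at hex
    have hsum : n i + n j = N := by
      rw [← hN, ← Finset.sum_pair hij]
      refine Finset.sum_subset (Finset.subset_univ _) fun p _ hp => ?_
      simp only [Finset.mem_insert, Finset.mem_singleton, not_or] at hp
      exact absurd (hex p hp.1) hp.2
    have hsame : ∀ (l : Fin k) (a c : EuclideanSpace ℝ (Fin (n l))), h l (x l) a c = 0 →
        ∑ q, h q (x q) ((Pi.single l a : ∀ i, EuclideanSpace ℝ (Fin (n i))) q)
        ((Pi.single l c : ∀ i, EuclideanSpace ℝ (Fin (n i))) q) = 0 := by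
      intro l a c hac
      refine Finset.sum_eq_zero fun q _ => ?_
      rcases eq_or_ne q l with rfl | hq
      · simpa using hac
      · simp [Pi.single_eq_of_ne hq]
    rcases (by omega : 2 ≤ n i ∨ 2 ≤ n j) with h2 | h2
    · obtain ⟨c, hc, hac⟩ := hdim i u h2
      exact key hij hij u v c hc (hsame i u c hac)
    · obtain ⟨c, hc, hac⟩ := hdim j v h2
      rw [dirDeriv_comm hF hU hx]
      exact key hij.symm hij.symm v u c hc (hsame j v c hac)

end isometric
end

/-! ### The isometric lift, and passage from derivatives to differences. -/

noncomputable section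

section embed
variable {N : ℕ} (T : LightConeTriple N) {X : Type*} [NormedAddCommGroup X] [NormedSpace ℝ X]
  {U : Set X} {x : X} {f : X → EuclideanSpace ℝ (Fin N)} {r : X → ℝ}

theorem LightConeTriple.contDiff_embed : ContDiff ℝ ∞ T.embed := by
  have h : ContDiff ℝ ∞ fun x => T.A x := T.A.toContinuousLinearMap.contDiff
  exact (contDiff_const.add h).sub ((contDiff_const.mul (contDiff_norm_sq ℝ)).smul contDiff_const)

theorem LightConeTriple.dirDeriv_embed_comp (hf : DifferentiableAt ℝ f x) (u : X) :
    dirDeriv u (fun y => T.embed (f y)) x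
      = T.A (dirDeriv u f x) - (inner ℝ (f x) (dirDeriv u f x) : ℝ) • T.w := by
  have hA : HasFDerivAt (fun y => T.A y) T.A.toContinuousLinearMap (f x) :=
    T.A.toContinuousLinearMap.hasFDerivAt
  have h := ((hA.comp x hf.hasFDerivAt).const_add T.p₀).sub
    (((hf.hasFDerivAt.norm_sq).const_mul (1 / 2)).smul_const T.w)
  have h' : HasFDerivAt (fun y => T.embed (f y)) _ x := h
  rw [dirDeriv, h'.fderiv]
  simp [dirDeriv]

/-- `T.embed ∘ f` is light-like, hence orthogonal to its derivatives, so every term with a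
derivative of `r` vanishes. -/
theorem LightConeTriple.lorentz_dirDeriv_smul_embed (hf : DifferentiableAt ℝ f x)
    (hr : DifferentiableAt ℝ r x) (u v : X) :
    lorentz (dirDeriv u (fun y => r y • T.embed (f y)) x)
        (dirDeriv v (fun y => r y • T.embed (f y)) x)
      = r x ^ 2 * inner ℝ (dirDeriv u f x) (dirDeriv v f x) := by
  have he : DifferentiableAt ℝ (fun y => T.embed (f y)) x :=
    (T.contDiff_embed.differentiable (by simp)).differentiableAt.comp x hf
  rw [dirDeriv_smul hr he, dirDeriv_smul hr he, T.dirDeriv_embed_comp hf, T.dirDeriv_embed_comp hf]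
  simp only [lorentz_add_left, lorentz_add_right, lorentz_smul_left, lorentz_smul_right,
    lorentz_sub_left, lorentz_sub_right, T.lorentz_embed_self, T.lorentz_embed_A,
    T.lorentz_embed_w, lorentz_comm (T.A _) (T.embed _), lorentz_comm T.w (T.embed _), T.lorentz_A,
    T.lorentz_A_w, T.lorentz_w_A, T.lorentz_w_w]
  ring

end embed

variable {k : ℕ} {n : Fin k → ℕ} {N : ℕ} {B : ∀ i, Set (EuclideanSpace ℝ (Fin (n i)))}

/-- Along a box, the second mixed difference of a function with vanishing second mixed derivatives
vanishes. -/
theorem mixed_difference_eq_zero {Y : Type*} [NormedAddCommGroup Y] [NormedSpace ℝ Y]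
    {F : (∀ i, EuclideanSpace ℝ (Fin (n i))) → Y} (hB : ∀ i, IsOpen (B i))
    (hBc : ∀ i, Convex ℝ (B i)) (hF : ContDiffOn ℝ ∞ F (Set.univ.pi B)) {i j : Fin k} (hij : i ≠ j)
    (h : ∀ x ∈ Set.univ.pi B, ∀ u v,
      dirDeriv (Pi.single i u) (dirDeriv (Pi.single j v) F) x = 0)
    {q : ∀ i, EuclideanSpace ℝ (Fin (n i))} (hq : q ∈ Set.univ.pi B)
    {y : EuclideanSpace ℝ (Fin (n i))} (hy : y ∈ B i) {t : EuclideanSpace ℝ (Fin (n j))}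
    (ht : t ∈ B j) :
    F (Function.update (Function.update q i y) j t) + F q
      = F (Function.update q i y) + F (Function.update q j t) := by
  have hU : IsOpen (Set.univ.pi B) := isOpen_set_pi Set.finite_univ fun i _ => hB i
  set a : ∀ i, EuclideanSpace ℝ (Fin (n i)) := Pi.single i (y - q i) with ha
  set b : ∀ i, EuclideanSpace ℝ (Fin (n i)) := Pi.single j (t - q j) with hb
  have hmem : ∀ r ∈ Set.Icc (0 : ℝ) 1, ∀ s ∈ Set.Icc (0 : ℝ) 1, q + s • b + r • a ∈
      Set.univ.pi B := by
    intro r hr s hs l _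
    rcases eq_or_ne l i with rfl | hl
    · have := (hBc l).add_smul_sub_mem (hq l trivial) hy hr
      simpa [ha, hb, Pi.single_eq_of_ne hij] using this
    · rcases eq_or_ne l j with rfl | hl'
      · have := (hBc l).add_smul_sub_mem (hq l trivial) ht hs
        simpa [ha, hb, Pi.single_eq_of_ne hl] using this
      · simpa [ha, hb, Pi.single_eq_of_ne hl, Pi.single_eq_of_ne hl'] using hq l trivial
  have h0 : (0 : ℝ) ∈ Set.Icc (0 : ℝ) 1 := by simp
  have h1 : (1 : ℝ) ∈ Set.Icc (0 : ℝ) 1 := by simp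
  have hdF : ∀ x ∈ Set.univ.pi B, DifferentiableAt ℝ F x := fun x hx =>
    hF.differentiableAt_of_isOpen hU hx
  have hm1 : ∀ s ∈ Set.Icc (0 : ℝ) 1, q + s • b + a ∈ Set.univ.pi B := fun s hs => by
    simpa using hmem 1 h1 s hs
  have hm0 : ∀ s ∈ Set.Icc (0 : ℝ) 1, q + s • b ∈ Set.univ.pi B := fun s hs => by
    simpa using hmem 0 h0 s hs
  -- Integration along `a` shows that `∂_b F` is unchanged by the shift by `a`; `final` then
  -- integrates along `b`. Both segments stay in the box by convexity.
  have key : ∀ s ∈ Set.Icc (0 : ℝ) 1,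
      dirDeriv b F (q + s • b + a) = dirDeriv b F (q + s • b) := by
    intro s hs
    refine eq_of_dirDeriv_eq_zero (fun r hr => ?_) (fun r hr => ?_)
    · exact (hF.contDiffOn_dirDeriv hU b).differentiableAt_of_isOpen hU (hmem r hr s hs)
    · exact h _ (hmem r hr s hs) _ _
  have hsh : ∀ s ∈ Set.Icc (0 : ℝ) 1, HasFDerivAt (fun x => F (x + a) - F x)
      (fderiv ℝ F (q + s • b + a) - fderiv ℝ F (q + s • b)) (q + s • b) := by
    intro s hs
    exact ((hasFDerivAt_comp_add_right a).2 (hdF _ (hm1 s hs)).hasFDerivAt).sub (hdF _ (hm0 s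
        hs)).hasFDerivAt
  have final : F (q + b + a) - F (q + b) = F (q + a) - F q := by
    refine eq_of_dirDeriv_eq_zero (G := fun x => F (x + a) - F x) (x := q) (a := b)
      (fun s hs => (hsh s hs).differentiableAt) (fun s hs => ?_)
    rw [dirDeriv, (hsh s hs).fderiv]
    exact sub_eq_zero.2 (key s hs)
  have e1 : q + a = Function.update q i y := by
    ext1 l
    rcases eq_or_ne l i with rfl | hl
    · simp [ha]
    · simp [ha, hl]
  have e2 : q + b = Function.update q j t := by
    ext1 l
    rcases eq_or_ne l j with rfl | hl
    · simp [hb]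
    · simp [hb, hl]
  have e3 : q + b + a = Function.update (Function.update q i y) j t := by
    rw [add_right_comm, e1]
    ext1 l
    rcases eq_or_ne l j with rfl | hl
    · simp [hb, hij.symm]
    · simp [hb, hl]
  rw [e3, e2, e1] at final
  rw [sub_eq_sub_iff_add_eq_add] at final
  exact final

variable {f : (∀ i, EuclideanSpace ℝ (Fin (n i))) → EuclideanSpace ℝ (Fin N)}
  {φ : (∀ i, EuclideanSpace ℝ (Fin (n i))) → ℝ}
  {h : ∀ i, EuclideanSpace ℝ (Fin (n i)) →
      EuclideanSpace ℝ (Fin (n i)) →L[ℝ] EuclideanSpace ℝ (Fin (n i)) →L[ℝ] ℝ}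

/-- The conformal factor of a smooth conformal immersion of a Riemannian product is smooth. -/
theorem contDiffOn_conformalFactor (hn : ∀ i, 1 ≤ n i) (hB : ∀ i, IsOpen (B i))
    (hf : ContDiffOn ℝ ∞ f (Set.univ.pi B)) (hφ : ∀ x ∈ Set.univ.pi B, 0 < φ x)
    (hpos : ∀ x ∈ Set.univ.pi B, ∀ i v, v ≠ 0 → 0 < h i (x i) v v)
    (hconf : ∀ x ∈ Set.univ.pi B, ∀ u v,
      inner ℝ (dirDeriv u f x) (dirDeriv v f x) = φ x ^ 2 * ∑ i, h i (x i) (u i) (v i))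
    {i j : Fin k} (hij : i ≠ j) : ContDiffOn ℝ ∞ φ (Set.univ.pi B) := by
  rcases (Set.univ.pi B).eq_empty_or_nonempty with hemp | ⟨c, hc⟩
  · rw [hemp]; exact contDiffOn_empty
  have hU : IsOpen (Set.univ.pi B) := isOpen_set_pi Set.finite_univ fun i _ => hB i
  have hnt : ∀ l, ∃ v : EuclideanSpace ℝ (Fin (n l)), v ≠ 0 := fun l => by
    have : Nonempty (Fin (n l)) := ⟨⟨0, hn l⟩⟩
    exact exists_ne 0
  obtain ⟨u, hu⟩ := hnt i
  obtain ⟨v, hv⟩ := hnt j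
  let S : ∀ l, EuclideanSpace ℝ (Fin (n l)) → (∀ i, EuclideanSpace ℝ (Fin (n i))) → ℝ :=
    fun l a x => inner ℝ (dirDeriv (Pi.single l a) f x) (dirDeriv (Pi.single l a) f x)
  have hS : ∀ l a, ContDiffOn ℝ ∞ (S l a) (Set.univ.pi B) := fun l a =>
    (hf.contDiffOn_dirDeriv hU _).inner ℝ (hf.contDiffOn_dirDeriv hU _)
  have hSv : ∀ l a, ∀ x ∈ Set.univ.pi B, S l a x = φ x ^ 2 * h l (x l) a a := by
    intro l a x hx
    simp only [S]
    rw [hconf x hx, Finset.sum_eq_single l]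
    · simp
    · intro m _ hm
      simp [Pi.single_eq_of_ne hm]
    · simp
  -- `P` freezes all coordinates except the `i`-th at the point `c`.
  let P : (∀ i, EuclideanSpace ℝ (Fin (n i))) → ∀ i, EuclideanSpace ℝ (Fin (n i)) :=
    fun x => Function.update c i (x i)
  have hP : ContDiff ℝ ∞ P := by
    rw [contDiff_pi]
    intro l
    rcases eq_or_ne l i with rfl | hl
    · simp only [P, Function.update_self]
      exact (ContinuousLinearMap.proj (R := ℝ) (φ := fun i => EuclideanSpace ℝ (Fin (n i)))
          l).contDiff
    · simpa [P, hl] using contDiff_const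
  have hPU : Set.MapsTo P (Set.univ.pi B) (Set.univ.pi B) := by
    intro x hx l _
    rcases eq_or_ne l i with rfl | hl
    · simpa [P] using hx l trivial
    · simpa [P, hl] using hc l trivial
  have hSne : ∀ x ∈ Set.univ.pi B, S i u x ≠ 0 := fun x hx => by
    rw [hSv i u x hx]
    exact (mul_pos (pow_pos (hφ x hx) 2) (hpos x hx i u hu)).ne'
  have hcj := (hpos c hc j v hv).ne'
  -- At `P x` the ratio of `S j v` to `S i u` is `h j (c j) v v / h i (x i) u u`, in which `φ` has
  -- cancelled and the numerator is constant. Multiplying by `S i u x = φ² h i (x i) u u` isolates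
  -- `φ²` as an expression in the derivatives of `f`. This is where a second factor is needed.
  have hsq : ∀ x ∈ Set.univ.pi B,
      S i u x * S j v (P x) * (S i u (P x) * h j (c j) v v)⁻¹ = φ x ^ 2 := by
    intro x hx
    have hPx := hPU hx
    rw [hSv i u x hx, hSv j v _ hPx, hSv i u _ hPx]
    have e1 : P x i = x i := by simp [P]
    have e2 : P x j = c j := by simp [P, hij.symm]
    rw [e1, e2]
    have := (hpos x hx i u hu).ne'
    have := (hφ _ hPx).ne'
    field_simp
  have hsm : ContDiffOn ℝ ∞ (fun x => Real.sqrt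
      (S i u x * S j v (P x) * (S i u (P x) * h j (c j) v v)⁻¹)) (Set.univ.pi B) := by
    refine ContDiffOn.sqrt (ContDiffOn.mul ((hS i u).mul ((hS j v).comp hP.contDiffOn hPU))
      (ContDiffOn.inv (((hS i u).comp hP.contDiffOn hPU).mul contDiffOn_const) ?_)) ?_
    · exact fun x hx => mul_ne_zero (hSne _ (hPU hx)) hcj
    · intro x hx
      rw [hsq x hx]
      exact (pow_pos (hφ x hx) 2).ne'
  refine hsm.congr fun x hx => ?_
  rw [hsq x hx, Real.sqrt_sq (hφ x hx).le]

/-- A conformal immersion of a Riemannian product, lifted to an isometric immersion into the light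
cone, is smooth, isometric and has vanishing second mixed differences. -/
theorem smul_embed_local (T : LightConeTriple N) (hn : ∀ i, 1 ≤ n i) (hN : ∑ i, n i = N)
    (hN3 : 3 ≤ N) (hk : 2 ≤ k) (hB : ∀ i, IsOpen (B i)) (hBc : ∀ i, Convex ℝ (B i))
    (hf : ContDiffOn ℝ ∞ f (Set.univ.pi B)) (hφ : ∀ x ∈ Set.univ.pi B, 0 < φ x)
    (hpos : ∀ x ∈ Set.univ.pi B, ∀ i v, v ≠ 0 → 0 < h i (x i) v v)
    (hconf : ∀ x ∈ Set.univ.pi B, ∀ u v,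
      inner ℝ (dirDeriv u f x) (dirDeriv v f x) = φ x ^ 2 * ∑ i, h i (x i) (u i) (v i)) :
    ContDiffOn ℝ ∞ (fun x => (φ x)⁻¹ • T.embed (f x)) (Set.univ.pi B) ∧
    (∀ x ∈ Set.univ.pi B, ∀ u v, lorentz (dirDeriv u (fun x => (φ x)⁻¹ • T.embed (f x)) x)
      (dirDeriv v (fun x => (φ x)⁻¹ • T.embed (f x)) x) = ∑ i, h i (x i) (u i) (v i)) ∧
    ∀ i j : Fin k, i ≠ j → ∀ q ∈ Set.univ.pi B, ∀ y ∈ B i, ∀ t ∈ B j,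
      (φ (Function.update (Function.update q i y) j t))⁻¹ •
          T.embed (f (Function.update (Function.update q i y) j t)) + (φ q)⁻¹ • T.embed (f q)
        = (φ (Function.update q i y))⁻¹ • T.embed (f (Function.update q i y))
          + (φ (Function.update q j t))⁻¹ • T.embed (f (Function.update q j t)) := by
  have hU : IsOpen (Set.univ.pi B) := isOpen_set_pi Set.finite_univ fun i _ => hB i
  have hφs : ContDiffOn ℝ ∞ φ (Set.univ.pi B) :=
    contDiffOn_conformalFactor hn hB hf hφ hpos hconf (i := ⟨0, by omega⟩) (j := ⟨1, by omega⟩)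
      (by simp)
  have hρ : ContDiffOn ℝ ∞ (fun x => (φ x)⁻¹) (Set.univ.pi B) := hφs.inv fun x hx => (hφ x hx).ne'
  have hF : ContDiffOn ℝ ∞ (fun x => (φ x)⁻¹ • T.embed (f x)) (Set.univ.pi B) :=
    hρ.smul (T.contDiff_embed.comp_contDiffOn hf)
  have hiso : ∀ x ∈ Set.univ.pi B, ∀ u v, lorentz (dirDeriv u (fun x => (φ x)⁻¹ • T.embed (f x)) x)
      (dirDeriv v (fun x => (φ x)⁻¹ • T.embed (f x)) x) = ∑ i, h i (x i) (u i) (v i) := by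
    intro x hx u v
    rw [T.lorentz_dirDeriv_smul_embed (hf.differentiableAt_of_isOpen hU hx)
      (hρ.differentiableAt_of_isOpen hU hx), hconf x hx, ← mul_assoc, ← mul_pow,
      inv_mul_cancel₀ (hφ x hx).ne', one_pow, one_mul]
  refine ⟨hF, hiso, fun i j hij q hq y hy t ht => ?_⟩
  refine mixed_difference_eq_zero hB hBc hF hij (fun x hx u v => ?_) hq hy ht
  refine dirDeriv_dirDeriv_mixed_eq_zero hn hN hN3 hU hF (w := T.w) (fun x _ => ?_) (fun x hx => ?_)
    hpos hiso hij u v hx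
  · simp [lorentz_smul_left, lorentz_smul_right, T.lorentz_embed_self]
  · rw [lorentz_smul_left, T.lorentz_embed_w, mul_one]
    exact inv_ne_zero (hφ x hx).ne'

/-- Connectedness is used one variable at a time. For a fixed `a`, the relation is chained along
`C`, intersecting neighbourhoods of `a` at each composition. The result is local in `A` for
arbitrary `s`, `t`, and is then chained along `A`. -/
theorem mixed_difference_of_local {A C Y : Type*} [TopologicalSpace A] [TopologicalSpace C]
    [PreconnectedSpace A] [PreconnectedSpace C] [AddCommGroup Y] (H : A → C → Y)
    (hloc : ∀ a c, ∃ U ∈ nhds a, ∃ V ∈ nhds c, ∀ x ∈ U, ∀ y ∈ U, ∀ s ∈ V, ∀ t ∈ V,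
      H x s - H x t = H y s - H y t) (x y : A) (s t : C) : H x s - H x t = H y s - H y t := by
  have h1 : ∀ a s t, ∃ U ∈ nhds a, ∀ x ∈ U, ∀ y ∈ U, H x s - H x t = H y s - H y t := by
    intro a s t
    refine PreconnectedSpace.induction₂'
      (fun s t => ∃ U ∈ nhds a, ∀ x ∈ U, ∀ y ∈ U, H x s - H x t = H y s - H y t) ?_ ?_ s t
    · intro c
      obtain ⟨U, hU, V, hV, h⟩ := hloc a c
      filter_upwards [hV] with d hd
      exact ⟨⟨U, hU, fun x hx y hy => h x hx y hy c (mem_of_mem_nhds hV) d hd⟩,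
        ⟨U, hU, fun x hx y hy => h x hx y hy d hd c (mem_of_mem_nhds hV)⟩⟩
    · refine ⟨fun a b c hab hbc => ?_⟩
      obtain ⟨U, hU, h⟩ := hab
      obtain ⟨V, hV, h'⟩ := hbc
      refine ⟨U ∩ V, Filter.inter_mem hU hV, fun x hx y hy => ?_⟩
      have e1 := h x hx.1 y hy.1
      have e2 := h' x hx.2 y hy.2
      rw [← sub_add_sub_cancel (H x a) (H x b), e1, e2, sub_add_sub_cancel]
  refine PreconnectedSpace.induction₂' (fun x y => H x s - H x t = H y s - H y t) ?_ ?_ x y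
  · intro a
    obtain ⟨U, hU, h⟩ := h1 a s t
    filter_upwards [hU] with b hb
    exact ⟨h a (mem_of_mem_nhds hU) b hb, h b hb a (mem_of_mem_nhds hU)⟩
  · exact ⟨fun _ _ _ => Eq.trans⟩

/-- A function on a finite product all of whose mixed second differences vanish is a sum of
functions of one variable. -/
theorem eq_add_sum_of_mixed_difference {ι : Type*} [Fintype ι] [DecidableEq ι] {M : ι → Type*}
    {Y : Type*} [AddCommGroup Y]
    (F : (∀ i, M i) → Y) (h : ∀ i j, i ≠ j → ∀ q y t,
      F (Function.update (Function.update q i y) j t) + F q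
        = F (Function.update q i y) + F (Function.update q j t)) (o p : ∀ i, M i) :
    F p = F o + ∑ i, (F (Function.update o i (p i)) - F o) := by
  -- The increment in the `i`-th variable does not depend on which of the other variables have
  -- already been moved from `o` to `p`.
  have h1 : ∀ (s : Finset ι), ∀ i ∉ s, ∀ y, F (Function.update (s.piecewise p o) i y)
      - F (s.piecewise p o) = F (Function.update o i y) - F o := by
    intro s
    induction s using Finset.induction_on with
    | empty => intro i _ y; simp
    | insert j s hj ih =>
      intro i hi y
      have hij : i ≠ j := fun h => hi (by simp [h])
      rw [← ih i (fun h => hi (by simp [h])) y, Finset.piecewise_insert,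
        sub_eq_sub_iff_add_eq_add, Function.update_comm hij.symm]
      exact h i j hij _ y (p j)
  have h2 : ∀ s : Finset ι, F (s.piecewise p o) = F o + ∑ i ∈ s, (F (Function.update o i (p i)) - F
      o) := by
    intro s
    induction s using Finset.induction_on with
    | empty => simp
    | insert j s hj ih =>
      rw [Finset.sum_insert hj, ← h1 s j hj, Finset.piecewise_insert, add_left_comm, ← ih]
      abel
  simpa using h2 Finset.univ
end

/-! ### The lift on the manifold and its global splitting. -/

noncomputable section

variable {k : ℕ} {n : Fin k → ℕ} {M : Fin k → Type*}
    [∀ i, TopologicalSpace (M i)] [∀ i, ChartedSpace (EuclideanSpace ℝ (Fin (n i))) (M i)]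
    [∀ i, IsManifold (𝓡 (n i)) ∞ (M i)] {N : ℕ}

/-- The metric of a Riemannian manifold in the chart around `x`. -/
def chartMetric {m : ℕ} {X : Type*} [TopologicalSpace X] [ChartedSpace (EuclideanSpace ℝ (Fin m)) X]
    [IsManifold (𝓡 m) ∞ X] (g : RiemMetric m X) (x : X) (y : EuclideanSpace ℝ (Fin m)) :
    EuclideanSpace ℝ (Fin m) →L[ℝ] EuclideanSpace ℝ (Fin m) →L[ℝ] ℝ :=
  ContinuousLinearMap.bilinearComp
    (show EuclideanSpace ℝ (Fin m) →L[ℝ] EuclideanSpace ℝ (Fin m) →L[ℝ] ℝ from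
      g.inner ((extChartAt (𝓡 m) x).symm y))
    (show EuclideanSpace ℝ (Fin m) →L[ℝ] EuclideanSpace ℝ (Fin m) from chartFrame x y)
    (show EuclideanSpace ℝ (Fin m) →L[ℝ] EuclideanSpace ℝ (Fin m) from chartFrame x y)

theorem chartMetric_pos {m : ℕ} {X : Type*} [TopologicalSpace X]
    [ChartedSpace (EuclideanSpace ℝ (Fin m)) X] [IsManifold (𝓡 m) ∞ X] (g : RiemMetric m X) (x : X)
    {y : EuclideanSpace ℝ (Fin m)} (hy : y ∈ (extChartAt (𝓡 m) x).target)
    (v : EuclideanSpace ℝ (Fin m)) (hv : v ≠ 0) : 0 < chartMetric g x y v v := by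
  refine g.pos _ _ fun h => hv ((bijective_chartFrame x hy).1 ?_)
  rw [map_zero]
  exact h

theorem contDiffOn_comp_extChartAt_symm {Y : Type*} [NormedAddCommGroup Y] [NormedSpace ℝ Y]
    {f : (∀ i, M i) → Y} (hf : ContMDiff (prodModel n) 𝓘(ℝ, Y) ∞ f) (p : ∀ i, M i) :
    ContDiffOn ℝ ∞ (f ∘ (extChartAt (prodModel n) p).symm) (extChartAt (prodModel n) p).target := by
  have := IsManifold.pi (fun i => 𝓡 (n i)) ∞ M
  exact (hf.comp_contMDiffOn (contMDiffOn_extChartAt_symm (n := ∞) p)).contDiffOn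

theorem inner_dirDeriv_comp_extChartAt_symm (g : ∀ i, RiemMetric (n i) (M i))
    {f : (∀ i, M i) → EuclideanSpace ℝ (Fin N)} (hf : ContMDiff (prodModel n) (𝓡 N) ∞ f)
    {φ : (∀ i, M i) → ℝ}
    (hconf : ∀ (p : ∀ i, M i) (u v : TangentSpace (prodModel n) p),
      inner ℝ (mvfderiv (prodModel n) f p u) (mvfderiv (prodModel n) f p v)
        = φ p ^ 2 * productMetric g p u v) (p : ∀ i, M i)
    {x : ∀ i, EuclideanSpace ℝ (Fin (n i))} (hx : x ∈ (extChartAt (prodModel n) p).target)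
    (u v : ∀ i, EuclideanSpace ℝ (Fin (n i))) :
    inner ℝ (dirDeriv u (f ∘ (extChartAt (prodModel n) p).symm) x)
        (dirDeriv v (f ∘ (extChartAt (prodModel n) p).symm) x)
      = φ ((extChartAt (prodModel n) p).symm x) ^ 2
        * ∑ i, chartMetric (g i) (p i) (x i) (u i) (v i) := by
  have := IsManifold.pi (fun i => 𝓡 (n i)) ∞ M
  have h1 : MDifferentiableAt 𝓘(ℝ, ∀ i, EuclideanSpace ℝ (Fin (n i))) (prodModel n)
      (extChartAt (prodModel n) p).symm x :=
    ((contMDiffOn_extChartAt_symm (n := ∞) p).contMDiffAt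
      ((isOpen_extChartAt_prodModel_target p).mem_nhds hx)).mdifferentiableAt (by simp)
  have h2 : ∀ u : ∀ i, EuclideanSpace ℝ (Fin (n i)),
      dirDeriv u (f ∘ (extChartAt (prodModel n) p).symm) x
      = mvfderiv (prodModel n) f ((extChartAt (prodModel n) p).symm x)
        (mfderiv 𝓘(ℝ, ∀ i, EuclideanSpace ℝ (Fin (n i))) (prodModel n)
        (extChartAt (prodModel n) p).symm x u) := by
    intro u
    have h := mfderiv_comp_apply x
      (hf.mdifferentiableAt (x := (extChartAt (prodModel n) p).symm x) (by simp)) h1 u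
    rw [mfderiv_eq_fderiv] at h
    exact h
  rw [h2, h2, hconf, productMetric]
  congr 1
  refine Finset.sum_congr rfl fun i _ => ?_
  rw [mfderiv_proj_mfderiv_symm p hx, mfderiv_proj_mfderiv_symm p hx]
  rfl

/-- The lift of a conformal immersion of a Riemannian product to the light cone: locally around
each point it is smooth and isometric in each factor, and it splits. -/
theorem lift_at_point (T : LightConeTriple N) (hk : 2 ≤ k) (hn : ∀ i, 1 ≤ n i)
    (hN : ∑ i, n i = N) (hN3 : 3 ≤ N) (g : ∀ i, RiemMetric (n i) (M i))
    {f : (∀ i, M i) → EuclideanSpace ℝ (Fin N)} (hf : ContMDiff (prodModel n) (𝓡 N) ∞ f)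
    {φ : (∀ i, M i) → ℝ} (hφ : ∀ p, 0 < φ p)
    (hconf : ∀ (p : ∀ i, M i) (u v : TangentSpace (prodModel n) p),
      inner ℝ (mvfderiv (prodModel n) f p u) (mvfderiv (prodModel n) f p v)
        = φ p ^ 2 * productMetric g p u v) (p : ∀ i, M i) :
    (∃ W : ∀ i, Set (M i), (∀ i, W i ∈ nhds (p i)) ∧ ∀ i j : Fin k, i ≠ j →
      ∀ q : ∀ i, M i, (∀ i, q i ∈ W i) → ∀ y ∈ W i, ∀ t ∈ W j,
        (φ (Function.update (Function.update q i y) j t))⁻¹ •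
            T.embed (f (Function.update (Function.update q i y) j t)) + (φ q)⁻¹ • T.embed (f q)
          = (φ (Function.update q i y))⁻¹ • T.embed (f (Function.update q i y))
            + (φ (Function.update q j t))⁻¹ • T.embed (f (Function.update q j t))) ∧
    ∀ (i : Fin k) (z : Minkowski (N + 1)),
      ContMDiffAt (𝓡 (n i)) 𝓘(ℝ, Minkowski (N + 1)) ∞
        (fun y => (φ (Function.update p i y))⁻¹ • T.embed (f (Function.update p i y)) - z) (p i) ∧
      ∀ u v : TangentSpace (𝓡 (n i)) (p i),
        lorentz
          (mvfderiv (𝓡 (n i)) (fun y => (φ (Function.update p i y))⁻¹ •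
            T.embed (f (Function.update p i y)) - z) (p i) u)
          (mvfderiv (𝓡 (n i)) (fun y => (φ (Function.update p i y))⁻¹ •
            T.embed (f (Function.update p i y)) - z) (p i) v)
        = (g i).inner (p i) u v := by
  -- Balls inside the chart targets of the factors: their product is a convex box on which the
  -- Euclidean results apply.
  have hr : ∀ i, ∃ r > 0, Metric.ball (extChartAt (𝓡 (n i)) (p i) (p i)) r ⊆
      (extChartAt (𝓡 (n i)) (p i)).target := fun i =>
    Metric.mem_nhds_iff.1 (extChartAt_target_mem_nhds (p i))
  choose r hr0 hrt using hr
  set B : ∀ i, Set (EuclideanSpace ℝ (Fin (n i))) := fun i =>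
    Metric.ball (extChartAt (𝓡 (n i)) (p i) (p i)) (r i) with hBdef
  set c : ∀ i, EuclideanSpace ℝ (Fin (n i)) := fun i => extChartAt (𝓡 (n i)) (p i) (p i) with hc
  have hBo : ∀ i, IsOpen (B i) := fun i => Metric.isOpen_ball
  have hBc : ∀ i, Convex ℝ (B i) := fun i => convex_ball _ _
  have hcB : ∀ i, c i ∈ B i := fun i => Metric.mem_ball_self (hr0 i)
  have hUt : Set.univ.pi B ⊆ (extChartAt (prodModel n) p).target := by
    intro x hx
    rw [extChartAt_prodModel]
    exact fun i _ => hrt i (hx i trivial)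
  set s := (extChartAt (prodModel n) p).symm with hs
  have hsapp : ∀ x i, s x i = (extChartAt (𝓡 (n i)) (p i)).symm (x i) := by
    intro x i
    rw [hs, extChartAt_prodModel]; rfl
  obtain ⟨hF, hiso, hmix⟩ := smul_embed_local (B := B) (f := f ∘ s) (φ := φ ∘ s)
    (h := fun i y => chartMetric (g i) (p i) y) T hn hN hN3 hk hBo hBc
    ((contDiffOn_comp_extChartAt_symm hf p).mono hUt) (fun x _ => hφ _)
    (fun x hx i v hv => chartMetric_pos (g i) (p i) (hrt i (hx i trivial)) v hv)
    (fun x hx u v => inner_dirDeriv_comp_extChartAt_symm g hf hconf p (hUt hx) u v)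
  have hupd : ∀ (x : ∀ i, EuclideanSpace ℝ (Fin (n i))) (i : Fin k) (y : EuclideanSpace ℝ (Fin (n
      i))),
      s (Function.update x i y) = Function.update (s x) i ((extChartAt (𝓡 (n i)) (p i)).symm y)
          := by
    intro x i y
    ext1 l
    rw [hsapp]
    rcases eq_or_ne l i with rfl | hl
    · simp
    · simp [hl, hsapp]
  have hsc : s c = p := by
    ext1 i
    rw [hsapp]
    exact extChartAt_to_inv (I := 𝓡 (n i)) (p i)
  refine ⟨⟨fun i => (extChartAt (𝓡 (n i)) (p i)).source ∩ extChartAt (𝓡 (n i)) (p i) ⁻¹' B i,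
    fun i => Filter.inter_mem (extChartAt_source_mem_nhds (p i))
      ((continuousAt_extChartAt (p i)).preimage_mem_nhds ((hBo i).mem_nhds (hcB i))), ?_⟩, ?_⟩
  · intro i j hij q hq y hy t ht
    have h := hmix i j hij (fun l => extChartAt (𝓡 (n l)) (p l) (q l)) (fun l _ => (hq l).2)
      _ hy.2 _ ht.2
    have hsq : s (fun l => extChartAt (𝓡 (n l)) (p l) (q l)) = q := by
      ext1 l
      rw [hsapp]
      exact (extChartAt (𝓡 (n l)) (p l)).left_inv (hq l).1
    simp only [Function.comp_apply, hupd, hsq, (extChartAt (𝓡 (n i)) (p i)).left_inv hy.1,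
      (extChartAt (𝓡 (n j)) (p j)).left_inv ht.1] at h
    exact h
  -- The constant `z` does not affect derivatives; it will be the value of the lift at the base
  -- point, so that the summands vanish there.
  · intro i z
    set F : (∀ i, EuclideanSpace ℝ (Fin (n i))) → Minkowski (N + 1) :=
      fun x => ((φ ∘ s) x)⁻¹ • T.embed ((f ∘ s) x) with hFdef
    set G : M i → Minkowski (N + 1) :=
      fun y => (φ (Function.update p i y))⁻¹ • T.embed (f (Function.update p i y)) - z with hG
    have hGs : G ∘ (extChartAt (𝓡 (n i)) (p i)).symm = fun y => F (Function.update c i y) - z := by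
      funext y
      simp [hG, hFdef, hupd, hsc]
    have hFc : HasFDerivAt F (fderiv ℝ F c) c :=
      (hF.differentiableAt_of_isOpen (isOpen_set_pi Set.finite_univ fun i _ => hBo i)
        fun i _ => hcB i).hasFDerivAt
    have hup : ContDiff ℝ ∞ fun y => Function.update c i y := by
      rw [contDiff_pi]
      intro l
      rcases eq_or_ne l i with rfl | hl
      · simp only [Function.update_self]
        exact contDiff_id
      · simpa [hl] using contDiff_const
    have hmaps : Set.MapsTo (fun y => Function.update c i y) (B i) (Set.univ.pi B) := by
      intro y hy l _
      rcases eq_or_ne l i with rfl | hl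
      · simpa using hy
      · simpa [hl] using hcB l
    have hGsm : ContDiffAt ℝ ∞ (fun y => F (Function.update c i y) - z) (c i) :=
      ((hF.comp hup.contDiffOn hmaps).sub contDiffOn_const).contDiffAt ((hBo i).mem_nhds (hcB i))
    have hGm : ContMDiffAt (𝓡 (n i)) 𝓘(ℝ, Minkowski (N + 1)) ∞ G (p i) := by
      have h1 := (hGsm.contMDiffAt).comp (p i) (contMDiffAt_extChartAt (I := 𝓡 (n i)) (n := ∞) (x
          := p i))
      refine h1.congr_of_eventuallyEq ?_
      filter_upwards [extChartAt_source_mem_nhds (I := 𝓡 (n i)) (p i)] with y hy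
      change G y = (fun y => F (Function.update c i y) - z) (extChartAt (𝓡 (n i)) (p i) y)
      rw [← hGs, Function.comp_apply, (extChartAt (𝓡 (n i)) (p i)).left_inv hy]
    refine ⟨hGm, isometric_of_extChartAt (p i) (g i) (hGm.mdifferentiableAt (by simp)) ?_⟩
    intro u v
    have hd : ∀ u, dirDeriv u (G ∘ (extChartAt (𝓡 (n i)) (p i)).symm) (c i)
        = dirDeriv (Pi.single i u) F c := by
      intro u
      have h2 := hasFDerivAt_update (𝕜 := ℝ) c (c i)
      have hFc' : HasFDerivAt F (fderiv ℝ F c) (Function.update c i (c i)) := by simpa using hFc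
      have h3 := (hFc'.comp (c i) h2).sub_const z
      rw [hGs, dirDeriv]
      have h4 : HasFDerivAt (fun y => F (Function.update c i y) - z) _ (c i) := h3
      rw [h4.fderiv]
      refine congrArg (fderiv ℝ F c) ?_
      ext1 l
      rcases eq_or_ne l i with rfl | hl
      · simp
      · simp [Pi.single_eq_of_ne hl]
    have h5 := hiso c (fun i _ => hcB i) (Pi.single i u) (Pi.single i v)
    rw [Finset.sum_eq_single i] at h5
    · rw [Pi.single_eq_same, Pi.single_eq_same] at h5
      have h6 := (congrArg₂ lorentz (hd u) (hd v)).trans h5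
      exact h6
    · intro l _ hl
      simp [Pi.single_eq_of_ne hl]
    · simp

/-- A conformal immersion of a Riemannian product of total dimension `N ≥ 3` into `ℝ^N` lifts to
an isometric immersion into the light cone, which is a sum of maps of the factors. -/
theorem exists_lightCone_splitting [∀ i, ConnectedSpace (M i)] (T : LightConeTriple N) (hk : 2 ≤ k)
    (hn : ∀ i, 1 ≤ n i) (hN : ∑ i, n i = N) (hN3 : 3 ≤ N) (g : ∀ i, RiemMetric (n i) (M i))
    {f : (∀ i, M i) → EuclideanSpace ℝ (Fin N)} (hf : IsConformalLocalDiffeo g f) (o : ∀ i, M i) :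
    ∃ (ρ : (∀ i, M i) → ℝ) (G : ∀ i, M i → Minkowski (N + 1)), (∀ p, 0 < ρ p) ∧
      (∀ p, ρ p • T.embed (f p) = ρ o • T.embed (f o) + ∑ i, G i (p i)) ∧ (∀ i, G i (o i) = 0) ∧
      (∀ i, ContMDiff (𝓡 (n i)) 𝓘(ℝ, Minkowski (N + 1)) ∞ (G i)) ∧
      ∀ i (x : M i) (u v : TangentSpace (𝓡 (n i)) x),
        lorentz (mvfderiv (𝓡 (n i)) (G i) x u) (mvfderiv (𝓡 (n i)) (G i) x v)
          = (g i).inner x u v := by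
  obtain ⟨φ, hφ, hconf⟩ := hf.conformal
  have hpt := lift_at_point T hk hn hN hN3 g hf.isLocalDiffeomorph.contMDiff hφ hconf
  set F : (∀ i, M i) → Minkowski (N + 1) := fun p => (φ p)⁻¹ • T.embed (f p) with hF
  have hmix : ∀ i j, i ≠ j → ∀ q y t,
      F (Function.update (Function.update q i y) j t) + F q
        = F (Function.update q i y) + F (Function.update q j t) := by
    intro i j hij q y t
    -- All coordinates but the `i`-th and `j`-th are frozen at `q`, which reduces the claim to a
    -- function on `M i × M j`.
    have h := mixed_difference_of_local
      (fun y t => F (Function.update (Function.update q i y) j t)) ?_ y (q i) t (q j)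
    · simp only [Function.update_eq_self] at h
      have e1 : Function.update (Function.update q i y) j (q j) = Function.update q i y := by
        rw [Function.update_comm hij, Function.update_eq_self]
      rw [e1, sub_eq_sub_iff_add_eq_add] at h
      exact h.trans (add_comm _ _)
    · intro a c
      obtain ⟨W, hW, h⟩ := (hpt (Function.update (Function.update q i a) j c)).1
      refine ⟨W i, ?_, W j, ?_, ?_⟩
      · simpa [hij] using hW i
      · simpa using hW j
      · intro x hx y hy s hs t ht
        have h1 := h i j hij (Function.update (Function.update q i x) j s) ?_ y hy t ht
        · have e1 : Function.update (Function.update (Function.update q i x) j s) i y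
              = Function.update (Function.update q i y) j s := by
            rw [Function.update_comm hij.symm, Function.update_idem]
          have e2 : ∀ x, Function.update (Function.update (Function.update q i x) j s) j t
              = Function.update (Function.update q i x) j t := by
            intro x
            rw [Function.update_idem]
          rw [e1, e2, e2] at h1
          rw [sub_eq_sub_iff_add_eq_add]
          exact (add_comm _ _).trans h1
        · intro l
          rcases eq_or_ne l j with rfl | hlj
          · simpa using hs
          · rcases eq_or_ne l i with rfl | hli
            · simpa [hlj] using hx
            · have := mem_of_mem_nhds (hW l)
              simpa [hlj, hli] using this
  refine ⟨fun p => (φ p)⁻¹, fun i x => F (Function.update o i x) - F o,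
    fun p => inv_pos.2 (hφ p), fun p => eq_add_sum_of_mixed_difference F hmix o p, by simp, ?_, ?_⟩
  · intro i x
    have h := ((hpt (Function.update o i x)).2 i (F o)).1
    simpa using h
  · intro i x u v
    have h := ((hpt (Function.update o i x)).2 i (F o)).2
    -- The slice in the `i`-th direction through `Function.update o i x` is the slice through `o`,
    -- so the local statement at that point concerns the globally defined summand.
    simp only [Function.update_idem] at h
    rw [Function.update_self] at h
    exact h u v
end

/-! ### The map `Θ` is a conformal diffeomorphism onto an open set. -/

noncomputable section

namespace LightConeTriple
variable {N : ℕ} (T : LightConeTriple N)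

/-- On `w^⊥` the Lorentz product degenerates exactly along `w`, and the coordinates along `A`
identify the quotient `w^⊥ / ℝ w` with `ℝ^N`. -/
theorem inner_of_lorentz_w_eq_zero {y y' : Minkowski (N + 1)} (hy : lorentz y T.w = 0)
    (hy' : lorentz y' T.w = 0) :
    inner ℝ (WithLp.toLp 2 fun j => lorentz y (T.A (EuclideanSpace.single j 1)) : EuclideanSpace ℝ
        (Fin N))
      (WithLp.toLp 2 fun j => lorentz y' (T.A (EuclideanSpace.single j 1)) : EuclideanSpace ℝ (Fin
          N))
      = lorentz y y' := by
  have key : ∀ y, lorentz y T.w = 0 → ∃ (b : ℝ) (x : EuclideanSpace ℝ (Fin N)),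
      y = b • T.w + T.A x ∧ (WithLp.toLp 2 fun j => lorentz y (T.A (EuclideanSpace.single j 1)) :
        EuclideanSpace ℝ (Fin N)) = x := by
    intro y hy
    obtain ⟨a, b, x, rfl⟩ := T.exists_decomp y
    have ha : a = 0 := by
      simpa [lorentz_add_left, lorentz_smul_left, T.lorentz_p₀_w, T.lorentz_w_w, T.lorentz_A_w]
        using hy
    refine ⟨b, x, by simp [ha], ?_⟩
    ext j
    simp [lorentz_add_left, lorentz_smul_left, T.lorentz_p₀_A, T.lorentz_w_A, T.lorentz_A,
      EuclideanSpace.inner_single_right]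
  obtain ⟨b, x, h1, h2⟩ := key y hy
  obtain ⟨b', x', h1', h2'⟩ := key y' hy'
  rw [h2, h2', h1, h1']
  simp [lorentz_add_left, lorentz_add_right, lorentz_smul_left, lorentz_smul_right, T.lorentz_w_w,
    T.lorentz_w_A, T.lorentz_A_w, T.lorentz_A]

theorem contDiffAt_toEuclidean {z : Minkowski (N + 1)} (hz : lorentz z T.w ≠ 0) :
    ContDiffAt ℝ ∞ T.toEuclidean z := by
  rw [contDiffAt_euclidean]
  intro j
  have h : ∀ a, ContDiffAt ℝ ∞ (fun z : Minkowski (N + 1) => lorentz z a) z := fun a =>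
    ((lorentzL _).flip a).contDiff.contDiffAt
  exact (h _).div (h _) hz

/-- The quotient rule, arranged so that the vector in the bracket is orthogonal to `w` and the
preceding identification applies. -/
theorem dirDeriv_toEuclidean {z : Minkowski (N + 1)} (hz : lorentz z T.w ≠ 0)
    (ζ : Minkowski (N + 1)) :
    dirDeriv ζ T.toEuclidean z = (lorentz z T.w)⁻¹ • WithLp.toLp 2 fun j =>
      lorentz (ζ - (lorentz ζ T.w / lorentz z T.w) • z) (T.A (EuclideanSpace.single j 1)) := by
  ext j
  have h : ∀ a, HasFDerivAt (fun z : Minkowski (N + 1) => lorentz z a) ((lorentzL _).flip a) z :=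
    fun a => ((lorentzL _).flip a).hasFDerivAt
  have h1 : HasFDerivAt (fun z => T.toEuclidean z j) _ z :=
    (h (T.A (EuclideanSpace.single j 1))).fun_mul ((hasDerivAt_inv hz).comp_hasFDerivAt z (h T.w))
  have h2 : HasFDerivAt (fun z => T.toEuclidean z j)
      ((EuclideanSpace.proj j : EuclideanSpace ℝ (Fin N) →L[ℝ] ℝ).comp (fderiv ℝ T.toEuclidean z))
          z :=
    (EuclideanSpace.proj j : EuclideanSpace ℝ (Fin N) →L[ℝ] ℝ).hasFDerivAt.comp z
      ((T.contDiffAt_toEuclidean hz).differentiableAt (by simp)).hasFDerivAt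
  have h3 := congrArg (fun L => L ζ) (h2.unique h1)
  change (fderiv ℝ T.toEuclidean z ζ) j = _ at h3
  rw [dirDeriv, h3]
  simp [lorentz_sub_left, lorentz_smul_left]
  field_simp
  ring

/-- The projection of the cone is conformal: the correction by a multiple of `z` is invisible to the
product, as `z` is light-like and orthogonal to `ζ` and `ζ'`. -/
theorem inner_dirDeriv_toEuclidean {z : Minkowski (N + 1)} (hz : lorentz z T.w ≠ 0)
    (hzz : lorentz z z = 0) {ζ ζ' : Minkowski (N + 1)} (hζ : lorentz z ζ = 0)
    (hζ' : lorentz z ζ' = 0) :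
    inner ℝ (dirDeriv ζ T.toEuclidean z) (dirDeriv ζ' T.toEuclidean z)
      = |lorentz z T.w|⁻¹ ^ 2 * lorentz ζ ζ' := by
  rw [T.dirDeriv_toEuclidean hz, T.dirDeriv_toEuclidean hz, inner_smul_left, inner_smul_right,
    T.inner_of_lorentz_w_eq_zero]
  · simp only [lorentz_sub_left, lorentz_sub_right, lorentz_smul_left, lorentz_smul_right, hzz, hζ',
      lorentz_comm ζ z, hζ, inv_pow, sq_abs]
    simp
    ring
  all_goals
    rw [lorentz_sub_left, lorentz_smul_left, div_mul_cancel₀ _ hz, sub_self]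

end LightConeTriple

namespace LorentzSplitting
variable {N m n : ℕ} (S : LorentzSplitting N m n)

theorem lorentz_C_add_D (X X' : Minkowski m) (Y Y' : EuclideanSpace ℝ (Fin (n + 1))) :
    lorentz (S.C X + S.D Y) (S.C X' + S.D Y') = lorentz X X' + inner ℝ Y Y' := by
  rw [lorentz_add_left, lorentz_add_right, lorentz_add_right, S.lorentz_C, S.lorentz_D,
    S.lorentz_C_D, lorentz_comm (S.D Y), S.lorentz_C_D]
  ring

theorem injective : Function.Injective (S.C.coprod S.D) := by
  rw [injective_iff_map_eq_zero]
  rintro ⟨X, Y⟩ h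
  rw [LinearMap.coprod_apply] at h
  have h1 : ∀ X' Y', lorentz X X' + inner ℝ Y Y' = 0 := fun X' Y' => by
    rw [← S.lorentz_C_add_D, h, lorentz_zero_left]
  have hX : X = 0 := by
    have := h1 (timeReversal X) 0
    rw [lorentz_comm, lorentz_timeReversal, inner_zero_right, add_zero] at this
    simpa using this
  have hY : Y = 0 := by
    have := h1 0 Y
    rw [lorentz_zero_right, zero_add] at this
    simpa using this
  rw [hX, hY]; rfl

theorem surjective : Function.Surjective (S.C.coprod S.D) :=
  (LinearMap.injective_iff_surjective_of_finrank_eq_finrank (by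
    have := S.dim
    simp
    omega)).1 S.injective

end LorentzSplitting

variable {N m n : ℕ} (T : LightConeTriple N) (S : LorentzSplitting N m n) {c : ℝ}

theorem lorentz_self_of_mem_thetaDomain {q : Minkowski m × EuclideanSpace ℝ (Fin (n + 1))}
    (hq : q ∈ thetaDomain T S c) :
    lorentz (S.C q.1 + S.D q.2) (S.C q.1 + S.D q.2) = 0 := by
  rw [S.lorentz_C_add_D, hq.1.1, hq.2.1]
  ring

/-- Equal images mean proportional light-like vectors, and `C`, `D` are jointly injective. The
common value `-1 / c` forces the factor to be `±1`, and the choice of the sheet forces it to be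
positive. -/
theorem injOn_conformalTheta (hc : 0 < c) :
    Set.InjOn (conformalTheta T S) (thetaDomain T S c) := by
  intro q hq q' hq' h
  have e := T.embed_toEuclidean (lorentz_self_of_mem_thetaDomain T S hq) hq.2.2
  have e' := T.embed_toEuclidean (lorentz_self_of_mem_thetaDomain T S hq') hq'.2.2
  unfold conformalTheta at h
  rw [h, e'] at e
  set a := lorentz (S.C q.1 + S.D q.2) T.w with ha
  set a' := lorentz (S.C q'.1 + S.D q'.2) T.w with ha'
  have h1 : S.C.coprod S.D (a'⁻¹ • q') = S.C.coprod S.D (a⁻¹ • q) := by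
    rw [map_smul, map_smul]; exact e
  have h2 : q' = (a' * a⁻¹) • q := by
    rw [mul_smul, ← S.injective h1, smul_smul, mul_inv_cancel₀ hq'.2.2, one_smul]
  set r := a' * a⁻¹
  have hr : r ^ 2 = 1 := by
    have h3 := hq'.1.1
    rw [h2, Prod.smul_fst, lorentz_smul_left, lorentz_smul_right, hq.1.1] at h3
    field_simp at h3
    linarith
  have hr0 : 0 < r := by
    have h3 := hq'.1.2
    rw [h2, Prod.smul_fst, PiLp.smul_apply, smul_eq_mul] at h3
    exact (pos_iff_pos_of_mul_pos h3).2 hq.1.2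
  have hr1 : r = 1 := by nlinarith
  rw [h2, hr1, one_smul]

/-- A point is in the image exactly when its light-like ray has a nonzero component in `W`: only
then can the ray be rescaled to meet the hyperboloid and the sphere. In this form the image is
evidently open. -/
theorem image_conformalTheta (hc : 0 < c) :
    conformalTheta T S '' thetaDomain T S c = {x | ∃ Y, lorentz (T.embed x) (S.D Y) ≠ 0} := by
  ext x
  constructor
  · rintro ⟨q, hq, rfl⟩
    refine ⟨q.2, ?_⟩
    unfold conformalTheta
    rw [T.embed_toEuclidean (lorentz_self_of_mem_thetaDomain T S hq) hq.2.2, lorentz_smul_left]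
    refine mul_ne_zero (inv_ne_zero hq.2.2) ?_
    rw [lorentz_add_left, S.lorentz_C_D, S.lorentz_D, hq.2.1, zero_add]
    exact (one_div_pos.2 hc).ne'
  · rintro ⟨Y', hY'⟩
    obtain ⟨⟨X, Y⟩, hXY⟩ := S.surjective (T.embed x)
    rw [LinearMap.coprod_apply] at hXY
    have hY : Y ≠ 0 := by
      rintro rfl
      apply hY'
      rw [← hXY]
      simp [S.lorentz_C_D]
    have hnull : lorentz X X = -‖Y‖ ^ 2 := by
      have := T.lorentz_embed_self x
      rw [← hXY, S.lorentz_C_add_D, real_inner_self_eq_norm_sq] at this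
      linarith
    have hYp : 0 < ‖Y‖ := norm_pos_iff.2 hY
    have hXl : X (Fin.last m) ≠ 0 := by
      intro h0
      have h1 : 0 ≤ lorentz X X := by
        rw [lorentz, h0]
        simpa using Finset.sum_nonneg fun i _ => mul_self_nonneg (X (Fin.castSucc i))
      nlinarith
    -- The modulus of `r` normalises the component in `W` to length `1 / √c`; its sign places the
    -- other component on the upper sheet.
    obtain ⟨r, hr, hrX⟩ : ∃ r : ℝ, r ^ 2 = 1 / (c * ‖Y‖ ^ 2) ∧ 0 < r * X (Fin.last m) := by
      have hs : 0 < 1 / (c * ‖Y‖ ^ 2) := by positivity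
      rcases lt_or_gt_of_ne hXl with h | h
      · exact ⟨-√(1 / (c * ‖Y‖ ^ 2)), by rw [neg_sq, Real.sq_sqrt hs.le],
          mul_pos_of_neg_of_neg (neg_neg_of_pos (Real.sqrt_pos.2 hs)) h⟩
      · exact ⟨√(1 / (c * ‖Y‖ ^ 2)), Real.sq_sqrt hs.le, mul_pos (Real.sqrt_pos.2 hs) h⟩
    have hr0 : r ≠ 0 := by
      rintro rfl
      simp at hrX
    have hz : S.C (r • X) + S.D (r • Y) = r • T.embed x := by
      rw [map_smul, map_smul, ← smul_add, hXY]
    refine ⟨(r • X, r • Y), ⟨⟨?_, ?_⟩, ?_, ?_⟩, ?_⟩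
    · rw [lorentz_smul_left, lorentz_smul_right, hnull, ← mul_assoc, ← sq, hr]
      field_simp
    · simpa using hrX
    · change inner ℝ (r • Y) (r • Y) = 1 / c
      rw [inner_smul_left, inner_smul_right, real_inner_self_eq_norm_sq, ← mul_assoc]
      simp only [conj_trivial]
      rw [← sq, hr]
      field_simp
    · change lorentz (S.C (r • X) + S.D (r • Y)) T.w ≠ 0
      rw [hz, lorentz_smul_left, T.lorentz_embed_w, mul_one]
      exact hr0
    · change T.toEuclidean (S.C (r • X) + S.D (r • Y)) = x
      rw [hz, T.toEuclidean_smul_embed hr0]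

/-- The map `Θ` is a conformal diffeomorphism of its domain onto an open subset of `ℝ^N`. -/
theorem isConformalDiffeoOn_conformalTheta (hc : 0 < c) :
    IsConformalDiffeoOn (thetaDomain T S c) (conformalTheta T S) := by
  let J : Minkowski m × EuclideanSpace ℝ (Fin (n + 1)) →L[ℝ] Minkowski (N + 1) :=
    (S.C.coprod S.D).toContinuousLinearMap
  -- `Θ` is a linear map followed by the projection of the cone. Tangent vectors at `q` go to
  -- vectors orthogonal to `J q`, so the conformal factor is that of the projection.
  have hJ : conformalTheta T S = T.toEuclidean ∘ J := rfl
  refine ⟨injOn_conformalTheta T S hc, ?_, ?_, fun q => |lorentz (S.C q.1 + S.D q.2) T.w|⁻¹, ?_, ?_⟩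
  · rw [image_conformalTheta T S hc, Set.ofPred_exists]
    refine isOpen_iUnion fun Y => ?_
    have : Continuous fun x => lorentz (T.embed x) (S.D Y) :=
      ((lorentzL _).flip (S.D Y)).continuous.comp T.contDiff_embed.continuous
    exact this.isOpen_preimage _ isOpen_compl_singleton
  · intro q hq
    rw [hJ]
    exact (T.contDiffAt_toEuclidean (z := J q) hq.2.2).comp q J.contDiff.contDiffAt
  · intro q hq
    exact inv_pos.2 (abs_pos.2 hq.2.2)
  · intro q hq u u' v v' hu hu' hv hv'
    have hd : ∀ ζ, fderiv ℝ (conformalTheta T S) q ζ = dirDeriv (J ζ) T.toEuclidean (J q) := by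
      intro ζ
      rw [hJ, fderiv_comp q ((T.contDiffAt_toEuclidean (z := J q) hq.2.2).differentiableAt (by
          simp))
        J.differentiableAt, J.fderiv]
      rfl
    rw [hd, hd, T.inner_dirDeriv_toEuclidean (z := J q) hq.2.2
      (lorentz_self_of_mem_thetaDomain T S hq)]
    · exact congrArg _ (S.lorentz_C_add_D _ _ _ _)
    · exact (S.lorentz_C_add_D q.1 u q.2 v).trans (by rw [hu, hv, add_zero])
    · exact (S.lorentz_C_add_D q.1 u' q.2 v').trans (by rw [hu', hv', add_zero])
end

/-! ### The splitting at the base point: frames and a normal vector. -/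

noncomputable section

/-- The coordinates of the Lorentz-orthogonal projection to the range of `A`. -/
def lorentzAdjoint {m N : ℕ} (A : EuclideanSpace ℝ (Fin m) →ₗ[ℝ] Minkowski N) :
    Minkowski N →L[ℝ] EuclideanSpace ℝ (Fin m) :=
  LinearMap.toContinuousLinearMap
    { toFun := fun z => WithLp.toLp 2 fun l => lorentz z (A (EuclideanSpace.single l 1))
      map_add' := fun x y => by ext l; simp [lorentz_add_left]
      map_smul' := fun r x => by ext l; simp [lorentz_smul_left] }

theorem inner_lorentzAdjoint {m N : ℕ} (A : EuclideanSpace ℝ (Fin m) →ₗ[ℝ] Minkowski N)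
    (z : Minkowski N) (x : EuclideanSpace ℝ (Fin m)) :
    inner ℝ (lorentzAdjoint A z) x = lorentz z (A x) := by
  conv_rhs => rw [← (EuclideanSpace.basisFun (Fin m) ℝ).sum_repr x]
  simp [map_sum, lorentz_sum_right, lorentz_smul_right, lorentzAdjoint, PiLp.inner_apply]

section mvfderiv
variable {m : ℕ} {X : Type*} [TopologicalSpace X] [ChartedSpace (EuclideanSpace ℝ (Fin m)) X]
  {Y Z : Type*} [NormedAddCommGroup Y] [NormedSpace ℝ Y] [NormedAddCommGroup Z] [NormedSpace ℝ Z]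
  {G : X → Y} {x : X} {Q : Y → Z} {Q' : Y →L[ℝ] Z}

theorem mvfderiv_comp_of_hasFDerivAt (hG : MDifferentiableAt (𝓡 m) 𝓘(ℝ, Y) G x)
    (hQ : HasFDerivAt Q Q' (G x)) (u : TangentSpace (𝓡 m) x) :
    mvfderiv (𝓡 m) (fun y => Q (G y)) x u = Q' (mvfderiv (𝓡 m) G x u) := by
  have h := (hQ.hasMFDerivAt.comp x hG.hasMFDerivAt).mfderiv
  exact congrArg (fun L => L u) h

/-- The device by which every identity satisfied by the values of a `G i` is passed on to its
derivatives. -/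
theorem apply_mvfderiv_eq_zero_of_const (hG : MDifferentiableAt (𝓡 m) 𝓘(ℝ, Y) G x)
    (hQ : HasFDerivAt Q Q' (G x)) {c : Z} (hc : ∀ y, Q (G y) = c) (u : TangentSpace (𝓡 m) x) :
    Q' (mvfderiv (𝓡 m) G x u) = 0 := by
  rw [← mvfderiv_comp_of_hasFDerivAt hG hQ, funext hc, mvfderiv_const]
  rfl

end mvfderiv

variable {k : ℕ} {n : Fin k → ℕ} {M : Fin k → Type*}
    [∀ i, TopologicalSpace (M i)] [∀ i, ChartedSpace (EuclideanSpace ℝ (Fin (n i))) (M i)]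
    [∀ i, IsManifold (𝓡 (n i)) ∞ (M i)] {N : ℕ}

/-- Maps `G i` of Riemannian manifolds into `𝕃^(N+2)` such that `p ↦ o + ∑ i, G i (p i)` is an
isometric immersion of the product into the light cone, with an orthonormal frame `A i` of the
tangent space at some point and a light-like vector `ξ` which is normal at this point. -/
structure IsLightConeSplitting (g : ∀ i, RiemMetric (n i) (M i)) (o ξ : Minkowski (N + 1))
    (G : ∀ i, M i → Minkowski (N + 1))
    (A : ∀ i, EuclideanSpace ℝ (Fin (n i)) →ₗ[ℝ] Minkowski (N + 1)) : Prop where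
  o_o : lorentz o o = 0
  ξ_ξ : lorentz ξ ξ = 0
  o_ξ : lorentz o ξ = 1
  A_A_same : ∀ i u v, lorentz (A i u) (A i v) = inner ℝ u v
  A_A : ∀ i j, i ≠ j → ∀ u v, lorentz (A i u) (A j v) = 0
  A_o : ∀ i u, lorentz (A i u) o = 0
  A_ξ : ∀ i u, lorentz (A i u) ξ = 0
  decomp : ∀ z, z = lorentz z ξ • o + lorentz z o • ξ + ∑ i, A i (lorentzAdjoint (A i) z)
  A_G : ∀ i j, i ≠ j → ∀ u y, lorentz (A i u) (G j y) = 0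
  G_G : ∀ i j, i ≠ j → ∀ x y, lorentz (G i x) (G j y) = 0
  G_G_same : ∀ i x, 2 * lorentz o (G i x) + lorentz (G i x) (G i x) = 0
  contMDiff : ∀ i, ContMDiff (𝓡 (n i)) 𝓘(ℝ, Minkowski (N + 1)) ∞ (G i)
  isometric : ∀ i (x : M i) (u v : TangentSpace (𝓡 (n i)) x),
    lorentz (mvfderiv (𝓡 (n i)) (G i) x u) (mvfderiv (𝓡 (n i)) (G i) x v) = (g i).inner x u v
  exists_eq_zero : ∀ i, ∃ x, G i x = 0
  exists_mvfderiv_eq : ∀ i u, ∃ (x : M i) (v : TangentSpace (𝓡 (n i)) x),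
    mvfderiv (𝓡 (n i)) (G i) x v = A i u

theorem exists_isometry_piLp (hN : ∑ i, n i = N) :
    Nonempty (EuclideanSpace ℝ (Fin N) ≃ₗᵢ[ℝ] PiLp 2 fun i => EuclideanSpace ℝ (Fin (n i))) := by
  have h : Module.finrank ℝ (PiLp 2 fun i => EuclideanSpace ℝ (Fin (n i))) = N := by
    rw [(WithLp.linearEquiv 2 ℝ (∀ i, EuclideanSpace ℝ (Fin (n i)))).finrank_eq]
    simp [Module.finrank_pi_fintype, hN]
  exact ⟨((stdOrthonormalBasis ℝ (PiLp 2 fun i => EuclideanSpace ℝ (Fin (n i)))).reindex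
    (finCongr h)).repr.symm⟩

/-- Moving one factor away from `p₀` in the light-like condition gives the quadratic relation for
each `G i`; moving two gives their orthogonality. Differentiation at `p₀` makes the frames
orthogonal to `o` and to the other factors, so that `o` and all the frames together complete to a
light cone triple, whose `w` serves as `ξ`. -/
theorem exists_isLightConeSplitting (hN : ∑ i, n i = N) (g : ∀ i, RiemMetric (n i) (M i))
    {o : Minkowski (N + 1)} (ho : o ≠ 0) {G : ∀ i, M i → Minkowski (N + 1)} {p₀ : ∀ i, M i}
    (hnull : ∀ p : ∀ i, M i, lorentz (o + ∑ i, G i (p i)) (o + ∑ i, G i (p i)) = 0)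
    (hG0 : ∀ i, G i (p₀ i) = 0)
    (hGs : ∀ i, ContMDiff (𝓡 (n i)) 𝓘(ℝ, Minkowski (N + 1)) ∞ (G i))
    (hiso : ∀ i (x : M i) (u v : TangentSpace (𝓡 (n i)) x),
      lorentz (mvfderiv (𝓡 (n i)) (G i) x u) (mvfderiv (𝓡 (n i)) (G i) x v)
        = (g i).inner x u v) : ∃ ξ A, IsLightConeSplitting g o ξ G A := by
  have hoo : lorentz o o = 0 := by simpa [hG0] using hnull p₀
  have hd : ∀ i x, MDifferentiableAt (𝓡 (n i)) 𝓘(ℝ, Minkowski (N + 1)) (G i) x := fun i x =>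
    (hGs i).mdifferentiableAt (by simp)
  have hs1 : ∀ i x, ∑ l, G l (Function.update p₀ i x l) = G i x := by
    intro i x
    rw [Finset.sum_eq_single i]
    · simp
    · intro l _ hl
      simp [hl, hG0]
    · simp
  have hGq : ∀ i x, 2 * lorentz o (G i x) + lorentz (G i x) (G i x) = 0 := by
    intro i x
    have h := hnull (Function.update p₀ i x)
    rw [hs1] at h
    simp only [lorentz_add_left, lorentz_add_right, hoo, lorentz_comm (G i x) o] at h
    linarith
  have hGG : ∀ i j, i ≠ j → ∀ x y, lorentz (G i x) (G j y) = 0 := by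
    intro i j hij x y
    have h := hnull (Function.update (Function.update p₀ i x) j y)
    have hs2 : ∑ l, G l (Function.update (Function.update p₀ i x) j y l) = G i x + G j y := by
      rw [← Finset.sum_subset (Finset.subset_univ {i, j}), Finset.sum_pair hij]
      · simp [hij]
      · intro l _ hl
        simp only [Finset.mem_insert, Finset.mem_singleton, not_or] at hl
        simp [hl.1, hl.2, hG0]
    rw [hs2] at h
    simp only [lorentz_add_left, lorentz_add_right, hoo, lorentz_comm (G i x) o,
      lorentz_comm (G j y) o, lorentz_comm (G j y) (G i x)] at h
    have := hGq i x
    have := hGq j y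
    linarith
  have hframe : ∀ i, ∃ e : EuclideanSpace ℝ (Fin (n i)) ≃ₗ[ℝ] EuclideanSpace ℝ (Fin (n i)),
      ∀ u v, (g i).inner (p₀ i) (e u) (e v) = inner ℝ u v := by
    intro i
    exact exists_orthonormal_frame (V := EuclideanSpace ℝ (Fin (n i)))
      (finrank_euclideanSpace_fin (𝕜 := ℝ) (n := n i))
      (LinearMap.mk₂ ℝ (fun u v => (g i).inner (p₀ i) u v)
        (fun _ _ _ => by erw [map_add]; rfl)
        (fun _ _ _ => by erw [map_smul]; rfl) (fun _ _ _ => map_add _ _ _)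
        (fun _ _ _ => map_smul _ _ _))
      ((g i).symm (p₀ i)) ((g i).pos (p₀ i))
  choose e he using hframe
  let A : ∀ i, EuclideanSpace ℝ (Fin (n i)) →ₗ[ℝ] Minkowski (N + 1) := fun i =>
    (show EuclideanSpace ℝ (Fin (n i)) →ₗ[ℝ] Minkowski (N + 1) from
      (mvfderiv (𝓡 (n i)) (G i) (p₀ i)).toLinearMap) ∘ₗ (e i).toLinearMap
  have hAA : ∀ i u v, lorentz (A i u) (A i v) = inner ℝ u v := fun i u v =>
    (hiso i (p₀ i) (e i u) (e i v)).trans (he i u v)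
  have hAG : ∀ i j, i ≠ j → ∀ u y, lorentz (A i u) (G j y) = 0 := by
    intro i j hij u y
    exact apply_mvfderiv_eq_zero_of_const (hd i (p₀ i))
      (((lorentzL (N + 1)).flip (G j y)).hasFDerivAt) (c := 0) (fun x => hGG i j hij x y) (e i u)
  have hAA' : ∀ i j, i ≠ j → ∀ u v, lorentz (A i u) (A j v) = 0 := by
    intro i j hij u v
    exact apply_mvfderiv_eq_zero_of_const (hd j (p₀ j))
      ((lorentzL (N + 1) (A i u)).hasFDerivAt) (c := 0) (fun x => hAG i j hij u x) (e j v)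
  have hAo : ∀ i u, lorentz (A i u) o = 0 := by
    intro i u
    -- The quadratic relation is differentiated at `p₀`, where `G i` vanishes, so only its linear
    -- term `2 ⟨o, ·⟩` survives.
    have hq : HasFDerivAt (fun z => 2 * lorentzL (N + 1) o z + lorentzL (N + 1) z z) _ (G i (p₀
        i)) :=
      ((lorentzL (N + 1) o).hasFDerivAt.const_mul 2).add
      ((lorentzL (N + 1)).hasFDerivAt.clm_apply (hasFDerivAt_id (G i (p₀ i))))
    have h := apply_mvfderiv_eq_zero_of_const (hd i (p₀ i)) hq (c := 0) (fun x => hGq i x) (e i u)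
    simp [hG0] at h
    rw [lorentz_comm]
    exact h
  obtain ⟨ι⟩ := exists_isometry_piLp hN
  let B : EuclideanSpace ℝ (Fin N) →ₗ[ℝ] Minkowski (N + 1) :=
    ∑ i, A i ∘ₗ (PiLp.projₗ 2 (fun i => EuclideanSpace ℝ (Fin (n i))) i) ∘ₗ ι.toLinearMap
  have hB : ∀ x, B x = ∑ i, A i (ι x i) := fun x => by simp [B]
  obtain ⟨T', h1, h2⟩ := LightConeTriple.exists_extension ho hoo B
    (fun x y => by
      rw [hB, hB, lorentz_sum_left, ← ι.inner_map_map, PiLp.inner_apply]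
      refine Finset.sum_congr rfl fun i _ => ?_
      rw [lorentz_sum_right, Finset.sum_eq_single i, hAA]
      · exact fun j _ hj => hAA' i j hj.symm _ _
      · simp)
    (fun x => by
      rw [hB, lorentz_sum_left]
      exact Finset.sum_eq_zero fun i _ => hAo i _)
  have hAξ : ∀ i u, lorentz (A i u) T'.w = 0 := by
    intro i u
    have h3 := T'.lorentz_A_w (ι.symm (WithLp.toLp 2 (Pi.single i u)))
    rw [h2, hB, Finset.sum_eq_single i] at h3
    · simpa using h3
    · intro j _ hj
      simp [Pi.single_eq_of_ne hj]
    · simp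
  refine ⟨T'.w, A, hoo, T'.lorentz_w_w, by rw [← h1, T'.lorentz_p₀_w], hAA, hAA', hAo, hAξ, ?_,
    hAG, hGG, hGq, hGs, hiso, fun i => ⟨_, hG0 i⟩, fun i u => ⟨_, e i u, rfl⟩⟩
  intro z
  obtain ⟨a, b, x, rfl⟩ := T'.exists_decomp z
  rw [h1, h2, hB]
  have hoξ : lorentz o T'.w = 1 := by rw [← h1, T'.lorentz_p₀_w]
  have hadj : ∀ i, lorentzAdjoint (A i) (a • o + b • T'.w + ∑ j, A j (ι x j)) = ι x i := by
    intro i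
    refine ext_inner_right ℝ fun v => ?_
    rw [inner_lorentzAdjoint, lorentz_add_left, lorentz_add_left, lorentz_smul_left,
      lorentz_smul_left, lorentz_comm o, hAo, lorentz_comm T'.w, hAξ, lorentz_sum_left,
      Finset.sum_eq_single i, hAA]
    · ring
    · exact fun j _ hj => hAA' j i hj _ _
    · simp
  simp only [hadj, lorentz_add_left, lorentz_smul_left, lorentz_sum_left, hAo, hAξ, hoo,
    T'.lorentz_w_w, hoξ, lorentz_comm T'.w o]
  simp
end

/-! ### Isometric maps in equal dimensions. -/

noncomputable section

/-- A smooth isometric map between manifolds of equal dimension is a local isometry. -/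
theorem isLocalIsometryEuclidean_of_isometric {m : ℕ} {X : Type*} [TopologicalSpace X]
    [ChartedSpace (EuclideanSpace ℝ (Fin m)) X] [IsManifold (𝓡 m) ∞ X] (g : RiemMetric m X)
    {h : X → EuclideanSpace ℝ (Fin m)} (hs : ContMDiff (𝓡 m) (𝓡 m) ∞ h)
    (hi : ∀ (x : X) (u v : TangentSpace (𝓡 m) x),
      inner ℝ (mvfderiv (𝓡 m) h x u) (mvfderiv (𝓡 m) h x v) = g.inner x u v) :
    IsLocalIsometryEuclidean g h := by
  refine ⟨fun x => ?_, hi⟩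
  set e := extChartAt (𝓡 m) x with he
  have hto : IsOpen e.target := isOpen_extChartAt_target x
  have hsm : ContDiffOn ℝ ∞ (h ∘ e.symm) e.target :=
    (hs.comp_contMDiffOn (contMDiffOn_extChartAt_symm (n := ∞) x)).contDiffOn
  have hder : ∀ y ∈ e.target, ∃ L : EuclideanSpace ℝ (Fin m) ≃L[ℝ] EuclideanSpace ℝ (Fin m),
      HasFDerivAt (h ∘ e.symm) (L : EuclideanSpace ℝ (Fin m) →L[ℝ] EuclideanSpace ℝ (Fin m)) y := by
    intro y hy
    -- A vector in the kernel has length zero for the positive definite metric `g`; in equal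
    -- dimensions injectivity gives invertibility.
    have hinj : Function.Injective (fderiv ℝ (h ∘ e.symm) y) := by
      rw [injective_iff_map_eq_zero]
      intro u hu
      have h1 : dirDeriv u (h ∘ e.symm) y = _ :=
        dirDeriv_comp_extChartAt_symm x hy (hs.mdifferentiableAt (by simp)) u
      rw [dirDeriv, hu] at h1
      have h2 := hi (e.symm y) (chartFrame x y u) (chartFrame x y u)
      rw [← h1, inner_zero_left] at h2
      by_contra hu0
      have h3 := g.pos (e.symm y) (chartFrame x y u) fun h0 => hu0
        ((bijective_chartFrame x hy).1 (by rw [map_zero]; exact h0))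
      exact h3.ne h2
    refine ⟨(LinearEquiv.ofInjectiveEndo _ hinj).toContinuousLinearEquiv, ?_⟩
    exact (hsm.differentiableAt_of_isOpen hto hy).hasFDerivAt
  have hx : e x ∈ e.target := mem_extChartAt_target x
  obtain ⟨L, hL⟩ := hder _ hx
  have hat : ContDiffAt ℝ ∞ (h ∘ e.symm) (e x) := hsm.contDiffAt (hto.mem_nhds hx)
  -- Restriction to the chart target keeps the derivative invertible at every point of the source,
  -- which makes the inverse smooth on all of `R.target` and not merely at one point.
  let R := (hat.toOpenPartialHomeomorph (h ∘ e.symm) hL (by simp)).restrOpen e.target hto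
  have hRs : R.source ⊆ e.target := Set.inter_subset_right
  have hRsm : ContDiffOn ℝ ∞ R.symm R.target := by
    intro y hy
    have hy' := R.map_target hy
    obtain ⟨L', hL'⟩ := hder _ (hRs hy')
    exact (R.contDiffAt_symm hy hL' (hsm.contDiffAt (hto.mem_nhds (hRs hy')))).contDiffWithinAt
  refine ⟨{ toPartialEquiv := e.trans R.toPartialEquiv
            open_source := ?_
            open_target := ?_
            contMDiffOn_toFun := ?_
            contMDiffOn_invFun := ?_ }, ?_, ?_⟩
  · exact (continuousOn_extChartAt x).isOpen_inter_preimage (isOpen_extChartAt_source x)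
        R.open_source
  · have : (e.trans R.toPartialEquiv).target = R.target := by
      rw [PartialEquiv.trans_target]
      exact Set.inter_eq_left.2 fun y hy => hRs (R.map_target hy)
    rw [this]
    exact R.open_target
  · refine (hs.contMDiffOn (s := (e.trans R.toPartialEquiv).source)).congr fun y hy => ?_
    exact congrArg h (e.left_inv hy.1)
  · refine (contMDiffOn_extChartAt_symm (n := ∞) x).comp
      (hRsm.contMDiffOn.mono fun y hy => hy.1) fun y hy => hRs (R.map_target hy.1)
  · exact ⟨mem_extChartAt_source x, ContDiffAt.mem_toOpenPartialHomeomorph_source hat hL (by simp),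
        hx⟩
  · exact fun y hy => (congrArg h (e.left_inv hy.1)).symm
end

/-! ### The dichotomy, and the Euclidean case. -/

noncomputable section

variable {k : ℕ} {n : Fin k → ℕ} {M : Fin k → Type*}
    [∀ i, TopologicalSpace (M i)] [∀ i, ChartedSpace (EuclideanSpace ℝ (Fin (n i))) (M i)]
    [∀ i, IsManifold (𝓡 (n i)) ∞ (M i)] {N : ℕ} {g : ∀ i, RiemMetric (n i) (M i)}
    {o ξ : Minkowski (N + 1)} {G : ∀ i, M i → Minkowski (N + 1)}
    {A : ∀ i, EuclideanSpace ℝ (Fin (n i)) →ₗ[ℝ] Minkowski (N + 1)}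

namespace IsLightConeSplitting

theorem G_eq (h : IsLightConeSplitting g o ξ G A) (i : Fin k) (x : M i) :
    G i x = lorentz (G i x) ξ • o + lorentz (G i x) o • ξ + A i (lorentzAdjoint (A i) (G i x)) := by
  conv_lhs => rw [h.decomp (G i x)]
  rw [Finset.sum_eq_single i]
  · intro j _ hj
    have : lorentzAdjoint (A j) (G i x) = 0 := ext_inner_right ℝ fun v => by
      rw [inner_lorentzAdjoint, lorentz_comm, h.A_G j i hj, inner_zero_left]
    rw [this, map_zero]
  · simp

theorem mdifferentiableAt (h : IsLightConeSplitting g o ξ G A) (i : Fin k) (x : M i) :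
    MDifferentiableAt (𝓡 (n i)) 𝓘(ℝ, Minkowski (N + 1)) (G i) x :=
  (h.contMDiff i).mdifferentiableAt (by simp)

/-- This is the orthogonality of `G i x` and `G j y`: their frame components are orthogonal, and
only the light-like plane of `o` and `ξ` contributes. -/
theorem mul_add_mul_eq_zero (h : IsLightConeSplitting g o ξ G A) {i j : Fin k} (hij : i ≠ j) (x : M
    i) (y : M j) :
    lorentz (G i x) ξ * lorentz (G j y) o + lorentz (G i x) o * lorentz (G j y) ξ = 0 := by
  have h1 := h.G_G i j hij x y
  rw [h.G_eq i x, lorentz_add_left, lorentz_add_left, lorentz_smul_left, lorentz_smul_left,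
    h.A_G i j hij, lorentz_comm o, lorentz_comm ξ] at h1
  linarith

/-- If `⟨G i, o⟩` vanished identically, the quadratic relation would make `G i = a • o + A i t`
light-like, hence `t = 0` everywhere. This contradicts that `A i` consists of derivatives of `G i`.
-/
theorem exists_lorentz_o_ne_zero (h : IsLightConeSplitting g o ξ G A) (hn : ∀ i, 1 ≤ n i) (i : Fin
    k) : ∃ x, lorentz (G i x) o ≠ 0 := by
  by_contra! hcon
  have hadj : ∀ x, lorentzAdjoint (A i) (G i x) = 0 := by
    intro x
    have h1 := h.G_G_same i x
    rw [lorentz_comm o, hcon, mul_zero, zero_add] at h1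
    set t := lorentzAdjoint (A i) (G i x) with ht
    have h2 := h.G_eq i x
    rw [hcon, zero_smul, add_zero, ← ht] at h2
    rw [h2] at h1
    simp only [lorentz_add_left, lorentz_add_right, lorentz_smul_left, lorentz_smul_right, h.o_o,
      h.A_o, lorentz_comm o (A i t), h.A_A_same] at h1
    simpa using h1
  have : Nonempty (Fin (n i)) := ⟨⟨0, hn i⟩⟩
  obtain ⟨u, hu⟩ := exists_ne (0 : EuclideanSpace ℝ (Fin (n i)))
  obtain ⟨x, v, hv⟩ := h.exists_mvfderiv_eq i u
  have h3 := apply_mvfderiv_eq_zero_of_const (h.mdifferentiableAt i x)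
    (lorentzAdjoint (A i)).hasFDerivAt hadj v
  rw [hv] at h3
  have h4 := inner_lorentzAdjoint (A i) (A i u) u
  rw [h3, inner_zero_left, h.A_A_same] at h4
  exact hu (inner_self_eq_zero.1 h4.symm)

/-- Either the light-like vector `ξ` is orthogonal to all the `G i`, or there are two factors only,
one hyperbolic and one spherical. -/
theorem dichotomy (h : IsLightConeSplitting g o ξ G A) (hk : 2 ≤ k) (hn : ∀ i, 1 ≤ n i) :
    (∀ i x, lorentz (G i x) ξ = 0) ∨
    ∃ i j : Fin k, i ≠ j ∧ (∀ l, l = i ∨ l = j) ∧ ∃ μ : ℝ, 0 < μ ∧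
      (∀ x, lorentz (G i x) ξ = -μ * lorentz (G i x) o) ∧
      ∀ y, lorentz (G j y) ξ = μ * lorentz (G j y) o := by
  choose y hy using h.exists_lorentz_o_ne_zero hn
  -- The ratio at one point `y i` determines the ratio everywhere on each other factor, with
  -- opposite sign.
  set μ : Fin k → ℝ := fun i => lorentz (G i (y i)) ξ / lorentz (G i (y i)) o with hμ
  have h1 : ∀ i j, i ≠ j → ∀ x, lorentz (G i x) ξ = -μ j * lorentz (G i x) o := by
    intro i j hij x
    have := h.mul_add_mul_eq_zero hij x (y j)
    have := hy j
    simp only [hμ]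
    field_simp
    linarith
  have h2 : ∀ i j, i ≠ j → μ i = -μ j := by
    intro i j hij
    have h3 := h1 i j hij (y i)
    have h4 : lorentz (G i (y i)) ξ = μ i * lorentz (G i (y i)) o := by
      simp only [hμ]
      rw [div_mul_cancel₀ _ (hy i)]
    exact mul_right_cancel₀ (hy i) (h4.symm.trans h3)
  have : Nontrivial (Fin k) := Fin.nontrivial_iff_two_le.2 hk
  have h5 : ∀ i x, lorentz (G i x) ξ = μ i * lorentz (G i x) o := by
    intro i x
    obtain ⟨j, hj⟩ := exists_ne i
    rw [h1 i j hj.symm, ← h2 i j hj.symm]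
  by_cases hz : ∀ i, μ i = 0
  · exact Or.inl fun i x => by rw [h5, hz, zero_mul]
  · right
    push Not at hz
    obtain ⟨l, hl⟩ := hz
    obtain ⟨m, hm⟩ := exists_ne l
    -- Three numbers that are pairwise opposite are all zero, so a nonzero `μ l` excludes a third
    -- factor.
    have hall : ∀ p, p = l ∨ p = m := by
      intro p
      by_contra! hp
      have e1 := h2 p l hp.1
      have e2 := h2 p m hp.2
      have e3 := h2 m l hm
      exact hl (by linarith)
    have e3 := h2 m l hm
    rcases lt_or_gt_of_ne hl with hneg | hpos
    · refine ⟨l, m, hm.symm, hall, μ m, by linarith, fun x => ?_, h5 m⟩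
      rw [h5, e3, neg_neg]
    · refine ⟨m, l, hm, fun p => (hall p).symm, μ l, hpos, fun x => ?_, h5 l⟩
      rw [h5, e3]

section euclidean

/-- Here `G i` lies in the span of `ξ` and the range of `A i`. As `ξ` is light-like and orthogonal
to that range, the coordinates along `A i` carry the whole metric. -/
theorem isLocalIsometryEuclidean_lorentzAdjoint (h : IsLightConeSplitting g o ξ G A) (hξ : ∀ i x,
    lorentz (G i x) ξ = 0) (i : Fin k) :
    IsLocalIsometryEuclidean (g i) fun x => lorentzAdjoint (A i) (G i x) := by
  refine isLocalIsometryEuclidean_of_isometric (g i)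
    ((lorentzAdjoint (A i)).contDiff.contMDiff.comp (h.contMDiff i)) fun x u v => ?_
  have hd := h.mdifferentiableAt i x
  rw [mvfderiv_comp_of_hasFDerivAt hd (lorentzAdjoint (A i)).hasFDerivAt,
    mvfderiv_comp_of_hasFDerivAt hd (lorentzAdjoint (A i)).hasFDerivAt, ← h.isometric,
    ← h.A_A_same]
  -- The relation `G i = ⟨G i, o⟩ • ξ + A i (Aᵢ* G i)` as the vanishing of a linear map, so that it
  -- can be differentiated.
  let P : Minkowski (N + 1) →L[ℝ] Minkowski (N + 1) := ContinuousLinearMap.id ℝ _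
    - ((lorentzL (N + 1)).flip o).smulRight ξ
    - (A i).toContinuousLinearMap.comp (lorentzAdjoint (A i))
  have hP : ∀ z, P z = z - lorentz z o • ξ - A i (lorentzAdjoint (A i) z) := fun z => rfl
  have hPG : ∀ x, P (G i x) = 0 := by
    intro x
    rw [hP]
    nth_rw 1 [h.G_eq i x]
    rw [hξ, zero_smul, zero_add]
    abel
  have key : ∀ u : TangentSpace (𝓡 (n i)) x, mvfderiv (𝓡 (n i)) (G i) x u
      = lorentz (mvfderiv (𝓡 (n i)) (G i) x u) o • ξ
        + A i (lorentzAdjoint (A i) (mvfderiv (𝓡 (n i)) (G i) x u)) := by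
    intro u
    have h1 := apply_mvfderiv_eq_zero_of_const hd P.hasFDerivAt hPG u
    rw [hP, sub_sub, sub_eq_zero] at h1
    exact h1
  conv_rhs => rw [key u, key v]
  simp only [lorentz_add_left, lorentz_add_right, lorentz_smul_left, lorentz_smul_right, h.ξ_ξ,
    h.A_ξ, lorentz_comm ξ (A i _)]
  ring

/-- If all the `G i` are orthogonal to `ξ`, the Euclidean coordinates of `o + ∑ i, G i (p i)` with
respect to a light cone triple `(p₀, ξ, A')` are those of a product map up to an isometry. -/
theorem exists_isometryEquiv (h : IsLightConeSplitting g o ξ G A) (hN : ∑ i, n i = N) (hξ : ∀ i x,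
    lorentz (G i x) ξ = 0)
    (T : LightConeTriple N) (hT : T.w = ξ) (b : EuclideanSpace ℝ (Fin N)) :
    ∃ Φ : PiLp 2 (fun i => EuclideanSpace ℝ (Fin (n i))) ≃ᵢ EuclideanSpace ℝ (Fin N),
      ∀ p : ∀ i, M i, Φ (WithLp.toLp 2 fun i => lorentzAdjoint (A i) (G i (p i)))
        = b + lorentzAdjoint T.A (o + ∑ i, G i (p i)) := by
  let B : PiLp 2 (fun i => EuclideanSpace ℝ (Fin (n i))) →ₗ[ℝ] Minkowski (N + 1) :=
    ∑ i, A i ∘ₗ (PiLp.projₗ 2 (fun i => EuclideanSpace ℝ (Fin (n i))) i)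
  have hB : ∀ x, B x = ∑ i, A i (x i) := fun x => by simp [B]
  have hBξ : ∀ x, lorentz (B x) T.w = 0 := fun x => by
    rw [hB, lorentz_sum_left, hT]
    exact Finset.sum_eq_zero fun i _ => h.A_ξ i _
  -- Both the frames `A i` and `T.A` give orthonormal coordinates on `ξ^⊥` modulo `ξ`, so the change
  -- between them is an isometry.
  have hinner : ∀ x y, inner ℝ (((lorentzAdjoint T.A).toLinearMap ∘ₗ B) x)
      (((lorentzAdjoint T.A).toLinearMap ∘ₗ B) y) = inner ℝ x y := by
    intro x y
    refine (T.inner_of_lorentz_w_eq_zero (hBξ x) (hBξ y)).trans ?_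
    rw [hB, hB, lorentz_sum_left, PiLp.inner_apply]
    refine Finset.sum_congr rfl fun i _ => ?_
    rw [lorentz_sum_right, Finset.sum_eq_single i, h.A_A_same]
    · exact fun j _ hj => h.A_A i j hj.symm _ _
    · simp
  let Q := LinearMap.isometryOfInner ((lorentzAdjoint T.A).toLinearMap ∘ₗ B) hinner
  obtain ⟨ι⟩ := exists_isometry_piLp hN
  let Q' := Q.toLinearIsometryEquiv ι.toLinearEquiv.finrank_eq.symm
  refine ⟨Q'.toIsometryEquiv.trans (IsometryEquiv.addLeft (b + lorentzAdjoint T.A o)), fun p => ?_⟩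
  change b + lorentzAdjoint T.A o + lorentzAdjoint T.A (B _) = _
  rw [hB, map_add, add_assoc]
  congr 2
  have hAξ : lorentzAdjoint T.A ξ = 0 := ext_inner_right ℝ fun v => by
    rw [inner_lorentzAdjoint, ← hT, T.lorentz_w_A, inner_zero_left]
  rw [map_sum, map_sum]
  refine Finset.sum_congr rfl fun i _ => ?_
  conv_rhs => rw [h.G_eq i (p i)]
  rw [hξ, zero_smul, zero_add, map_add, map_smul, hAξ, smul_zero, zero_add]

end euclidean
end IsLightConeSplitting

theorem LightConeTriple.lorentzAdjoint_embed (T : LightConeTriple N)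
    (x : EuclideanSpace ℝ (Fin N)) : lorentzAdjoint T.A (T.embed x) = x :=
  ext_inner_right ℝ fun v => by rw [inner_lorentzAdjoint, T.lorentz_embed_A]

/-- The triple obtained by interchanging the roles of the points `b` and `∞`. -/
def LightConeTriple.swap (T : LightConeTriple N) (b : EuclideanSpace ℝ (Fin N)) {α : ℝ}
    (hα : α ≠ 0) : LightConeTriple N where
  p₀ := α⁻¹ • T.w
  w := α • T.embed b
  A := T.A - (innerₛₗ ℝ b).smulRight T.w
  lorentz_w_w := by simp [lorentz_smul_left, lorentz_smul_right, T.lorentz_embed_self]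
  lorentz_p₀_p₀ := by simp [lorentz_smul_left, lorentz_smul_right, T.lorentz_w_w]
  lorentz_p₀_w := by
    rw [lorentz_smul_left, lorentz_smul_right, lorentz_comm, T.lorentz_embed_w]
    field_simp
  lorentz_A := fun x y => by
    simp [lorentz_sub_left, lorentz_sub_right, lorentz_smul_left, lorentz_smul_right,
      T.lorentz_A, T.lorentz_A_w, T.lorentz_w_A, T.lorentz_w_w]
  lorentz_A_p₀ := fun x => by
    simp [lorentz_sub_left, lorentz_smul_left, lorentz_smul_right, T.lorentz_A_w, T.lorentz_w_w]
  lorentz_A_w := fun x => by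
    simp [lorentz_sub_left, lorentz_smul_left, lorentz_smul_right, lorentz_comm (T.A x),
      lorentz_comm T.w, T.lorentz_embed_A, T.lorentz_embed_w]

/-- Multiplied by the lift factor `ρ`, which will be proportional to `‖x - b‖⁻²`, this difference
becomes the vector of an inversion centred at `b`. -/
theorem LightConeTriple.lorentzAdjoint_swap_embed (T : LightConeTriple N)
    (b x : EuclideanSpace ℝ (Fin N)) {α : ℝ} (hα : α ≠ 0) :
    lorentzAdjoint (T.swap b hα).A (T.embed x) = x - b :=
  ext_inner_right ℝ fun v => by
    rw [inner_lorentzAdjoint, inner_sub_left]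
    change lorentz (T.embed x) (T.A v - (inner ℝ b v : ℝ) • T.w) = _
    rw [lorentz_sub_right, lorentz_smul_right, T.lorentz_embed_A, T.lorentz_embed_w, mul_one]

/-- The same triple with a rescaled point at infinity. -/
def LightConeTriple.rescale (T : LightConeTriple N) {β : ℝ} (hβ : β ≠ 0) : LightConeTriple N where
  p₀ := β⁻¹ • T.p₀
  w := β • T.w
  A := T.A
  lorentz_w_w := by simp [lorentz_smul_left, lorentz_smul_right, T.lorentz_w_w]
  lorentz_p₀_p₀ := by simp [lorentz_smul_left, lorentz_smul_right, T.lorentz_p₀_p₀]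
  lorentz_p₀_w := by
    rw [lorentz_smul_left, lorentz_smul_right, T.lorentz_p₀_w]
    field_simp
  lorentz_A := T.lorentz_A
  lorentz_A_p₀ := fun x => by rw [lorentz_smul_right, T.lorentz_A_p₀, mul_zero]
  lorentz_A_w := fun x => by rw [lorentz_smul_right, T.lorentz_A_w, mul_zero]

namespace IsLightConeSplitting

/-- The first form of a conformal immersion of a product. -/
theorem exists_euclidean_form (h : IsLightConeSplitting g o ξ G A) (hN : ∑ i, n i = N)
    (hξ : ∀ i x, lorentz (G i x) ξ = 0) (T : LightConeTriple N)
    {f : (∀ i, M i) → EuclideanSpace ℝ (Fin N)} {ρ : (∀ i, M i) → ℝ} (hρ : ∀ p, 0 < ρ p)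
    (hf : ∀ p, ρ p • T.embed (f p) = o + ∑ i, G i (p i)) [Nonempty (∀ i, M i)] :
    ∃ (Φ : PiLp 2 (fun i => EuclideanSpace ℝ (Fin (n i))) ≃ᵢ EuclideanSpace ℝ (Fin N))
        (F : ∀ i, M i → EuclideanSpace ℝ (Fin (n i)))
        (H : EuclideanSpace ℝ (Fin N) → EuclideanSpace ℝ (Fin N)),
      (∀ i, IsLocalIsometryEuclidean (g i) (F i)) ∧
      (∃ (a : EuclideanSpace ℝ (Fin N)) (r : ℝ), 0 < r ∧ H = AffineMap.homothety a r) ∧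
      ((∀ p, f p = H (Φ (WithLp.toLp 2 fun i => F i (p i)))) ∨
        ∃ (b : EuclideanSpace ℝ (Fin N)) (s : ℝ), 0 < s ∧
          ∀ p, H (Φ (WithLp.toLp 2 fun i => F i (p i))) ≠ b ∧
            f p = EuclideanGeometry.inversion b s (H (Φ (WithLp.toLp 2 fun i => F i (p i))))) := by
  -- The lift lies in the flat section `⟨·, ξ⟩ = 1`. This equation determines `ρ` from `f`.
  have hone : ∀ p, ρ p * lorentz (T.embed (f p)) ξ = 1 := by
    intro p
    rw [← lorentz_smul_left, hf, lorentz_add_left, h.o_ξ, lorentz_sum_left]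
    simp [hξ]
  have hloc := h.isLocalIsometryEuclidean_lorentzAdjoint hξ
  -- Two orthogonal light-like vectors are proportional, in which case `ξ` is again the point at
  -- infinity and `ρ` is constant. Otherwise `ξ` represents a finite point `b`.
  by_cases hα : lorentz ξ T.w = 0
  · obtain ⟨β, hβ⟩ : ∃ β : ℝ, ξ = β • T.w := by
      obtain ⟨a, b, x, hx⟩ := T.exists_decomp ξ
      have ha : a = 0 := by
        rw [hx] at hα
        simpa [lorentz_add_left, lorentz_smul_left, T.lorentz_p₀_w, T.lorentz_w_w, T.lorentz_A_w]
          using hα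
      have hx0 : x = 0 := by
        have h1 := h.ξ_ξ
        rw [hx, ha] at h1
        simpa [lorentz_add_left, lorentz_add_right, lorentz_smul_left, lorentz_smul_right,
          T.lorentz_w_w, T.lorentz_A_w, T.lorentz_w_A, T.lorentz_A] using h1
      exact ⟨b, by rw [hx, ha, hx0]; simp⟩
    have hρβ : ∀ p, ρ p * β = 1 := fun p => by
      have := hone p
      rwa [hβ, lorentz_smul_right, T.lorentz_embed_w, mul_one] at this
    obtain ⟨p⟩ := ‹Nonempty (∀ i, M i)›
    have hβ0 : 0 < β := (pos_iff_pos_of_mul_pos (by rw [hρβ p]; exact one_pos)).1 (hρ p)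
    obtain ⟨Φ, hΦ⟩ := h.exists_isometryEquiv hN hξ (T.rescale hβ0.ne') hβ.symm 0
    refine ⟨Φ, _, _, hloc, ⟨0, β, hβ0, rfl⟩, Or.inl fun p => ?_⟩
    rw [hΦ, zero_add, ← hf, map_smul]
    change f p = AffineMap.homothety 0 β (ρ p • lorentzAdjoint T.A (T.embed (f p)))
    rw [T.lorentzAdjoint_embed, AffineMap.homothety_apply]
    simp only [vsub_eq_sub, sub_zero, vadd_eq_add, add_zero]
    rw [smul_smul, mul_comm, hρβ, one_smul]
  · set α := lorentz ξ T.w with hαdef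
    set b := T.toEuclidean ξ with hb
    have hξb : α • T.embed b = ξ := by
      rw [hb, T.embed_toEuclidean h.ξ_ξ hα, smul_smul, mul_inv_cancel₀ hα, one_smul]
    have hdist : ∀ p, ρ p * (-α) * ‖f p - b‖ ^ 2 = 2 := by
      intro p
      have := hone p
      rw [← hξb, lorentz_smul_right, T.lorentz_embed_embed] at this
      linarith
    have hne : ∀ p, f p ≠ b := by
      intro p hp
      have := hdist p
      simp [hp] at this
    have hαn : 0 < -α := by
      obtain ⟨p⟩ := ‹Nonempty (∀ i, M i)›
      have h1 : 0 < ρ p * (-α) * ‖f p - b‖ ^ 2 := by rw [hdist]; norm_num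
      have h2 : 0 < ‖f p - b‖ ^ 2 := pow_pos (norm_pos_iff.2 (sub_ne_zero.2 (hne p))) 2
      exact (pos_iff_pos_of_mul_pos ((pos_iff_pos_of_mul_pos h1).2 h2)).1 (hρ p)
    obtain ⟨Φ, hΦ⟩ := h.exists_isometryEquiv hN hξ (T.swap b hα) hξb b
    -- By `hdist` the product map is `b + ρ (f - b)` with `ρ = (2 / -α) / ‖f - b‖²`, hence the
    -- squared radius `2 / -α`. An inversion is its own inverse, and the homothety can be taken
    -- trivial.
    have hinv : ∀ p, Φ (WithLp.toLp 2 fun i => lorentzAdjoint (A i) (G i (p i)))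
        = EuclideanGeometry.inversion b √(2 / -α) (f p) := by
      intro p
      rw [hΦ, ← hf, map_smul, T.lorentzAdjoint_swap_embed, EuclideanGeometry.inversion, div_pow,
        Real.sq_sqrt (by positivity), dist_eq_norm, vsub_eq_sub, vadd_eq_add, add_comm]
      congr 2
      have h2 : ‖f p - b‖ ≠ 0 := norm_ne_zero_iff.2 (sub_ne_zero.2 (hne p))
      rw [div_div, eq_div_iff (mul_ne_zero hαn.ne' (pow_ne_zero 2 h2)), ← mul_assoc, hdist]
    have hs : 0 < √(2 / -α) := Real.sqrt_pos.2 (by positivity)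
    refine ⟨Φ, _, _, hloc, ⟨0, 1, one_pos, rfl⟩, Or.inr ⟨b, √(2 / -α), hs, fun p => ?_⟩⟩
    simp only [AffineMap.homothety_one, AffineMap.id_apply]
    rw [hinv]
    exact ⟨fun h0 => hne p ((EuclideanGeometry.inversion_eq_center hs.ne').1 h0),
      (EuclideanGeometry.inversion_inversion b hs.ne' (f p)).symm⟩

end IsLightConeSplitting
end

/-! ### The hyperbolic–spherical case. -/

noncomputable section

/-- Appending a last coordinate. -/
def appendCoord (m : ℕ) : EuclideanSpace ℝ (Fin m) × ℝ →L[ℝ] EuclideanSpace ℝ (Fin (m + 1)) :=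
  LinearMap.toContinuousLinearMap
    { toFun := fun q => WithLp.toLp 2 (Fin.snoc (fun i => q.1 i) q.2)
      map_add' := fun x y => by
        ext i
        refine Fin.lastCases (by simp) (fun i => by simp) i
      map_smul' := fun r x => by
        ext i
        refine Fin.lastCases (by simp) (fun i => by simp) i }

@[simp] theorem appendCoord_castSucc {m : ℕ} (q : EuclideanSpace ℝ (Fin m) × ℝ) (i : Fin m) :
    appendCoord m q i.castSucc = q.1 i := by simp [appendCoord]

@[simp] theorem appendCoord_last {m : ℕ} (q : EuclideanSpace ℝ (Fin m) × ℝ) :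
    appendCoord m q (Fin.last m) = q.2 := by simp [appendCoord]

/-- Dropping the last coordinate. -/
def initCoords (m : ℕ) : EuclideanSpace ℝ (Fin (m + 1)) →ₗ[ℝ] EuclideanSpace ℝ (Fin m) where
  toFun x := WithLp.toLp 2 fun i => x i.castSucc
  map_add' x y := by ext i; simp
  map_smul' r x := by ext i; simp

/-- The linear map which extends `A` by sending the last basis vector to `η`. -/
def extendLast {m N : ℕ} (A : EuclideanSpace ℝ (Fin m) →ₗ[ℝ] Minkowski N) (η : Minkowski N) :
    EuclideanSpace ℝ (Fin (m + 1)) →ₗ[ℝ] Minkowski N :=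
  A ∘ₗ initCoords m + (EuclideanSpace.proj (Fin.last m) : _ →L[ℝ] ℝ).toLinearMap.smulRight η

theorem extendLast_apply {m N : ℕ} (A : EuclideanSpace ℝ (Fin m) →ₗ[ℝ] Minkowski N)
    (η : Minkowski N) (x : EuclideanSpace ℝ (Fin (m + 1))) :
    extendLast A η x = A (initCoords m x) + x (Fin.last m) • η := rfl

theorem extendLast_appendCoord {m N : ℕ} (A : EuclideanSpace ℝ (Fin m) →ₗ[ℝ] Minkowski N)
    (η : Minkowski N) (q : EuclideanSpace ℝ (Fin m) × ℝ) :
    extendLast A η (appendCoord m q) = A q.1 + q.2 • η := by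
  rw [extendLast_apply, appendCoord_last]
  congr 2
  ext i
  simp [initCoords]

theorem inner_initCoords {m : ℕ} (x y : EuclideanSpace ℝ (Fin (m + 1))) :
    inner ℝ (initCoords m x) (initCoords m y) = ∑ i : Fin m, x i.castSucc * y i.castSucc := by
  simp [initCoords, PiLp.inner_apply, mul_comm]

/-- One construction serves for both isometries: with `⟨η, η⟩ = -1` the form is Lorentzian and gives
`C`, with `⟨η, η⟩ = 1` it is Euclidean and gives `D`. -/
theorem lorentz_extendLast {m N : ℕ} {A : EuclideanSpace ℝ (Fin m) →ₗ[ℝ] Minkowski N}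
    {η : Minkowski N} (hA : ∀ u v, lorentz (A u) (A v) = inner ℝ u v)
    (hAη : ∀ u, lorentz (A u) η = 0) (x y : EuclideanSpace ℝ (Fin (m + 1))) :
    lorentz (extendLast A η x) (extendLast A η y) = ∑ i : Fin m, x i.castSucc * y i.castSucc
      + x (Fin.last m) * y (Fin.last m) * lorentz η η := by
  simp only [extendLast_apply, lorentz_add_left, lorentz_add_right, lorentz_smul_left,
    lorentz_smul_right, hA, hAη, lorentz_comm η (A _), inner_initCoords]
  ring

/-- The translations `z` and `v₀` disappear on differentiation. Hence the metric induced by the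
coordinate map, measured through the isometry `extendLast A η`, is that of `G`. -/
theorem eq_of_extendLast_comp {m N : ℕ} {X : Type*} [TopologicalSpace X]
    [ChartedSpace (EuclideanSpace ℝ (Fin m)) X] {G : X → Minkowski N}
    {A : EuclideanSpace ℝ (Fin m) →ₗ[ℝ] Minkowski N} {η z : Minkowski N}
    {L : Minkowski N →L[ℝ] EuclideanSpace ℝ (Fin (m + 1))} {v₀ : EuclideanSpace ℝ (Fin (m + 1))}
    (hL : ∀ x, extendLast A η (L (G x) + v₀) = z + G x) {x : X}
    (hG : MDifferentiableAt (𝓡 m) 𝓘(ℝ, Minkowski N) G x) (u : TangentSpace (𝓡 m) x) :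
    extendLast A η (mvfderiv (𝓡 m) (fun y => L (G y) + v₀) x u) = mvfderiv (𝓡 m) G x u := by
  rw [mvfderiv_comp_of_hasFDerivAt hG (L.hasFDerivAt.add_const v₀)]
  have h1 := apply_mvfderiv_eq_zero_of_const hG
    ((((extendLast A η).toContinuousLinearMap.comp L) - ContinuousLinearMap.id ℝ _).hasFDerivAt)
    (c := z - extendLast A η v₀) (fun y => by
      have := hL y
      rw [map_add] at this
      change extendLast A η (L (G y)) - G y = _
      rw [sub_eq_sub_iff_add_eq_add, this]) u
  exact sub_eq_zero.1 h1

variable {k : ℕ} {n : Fin k → ℕ} {M : Fin k → Type*}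
    [∀ i, TopologicalSpace (M i)] [∀ i, ChartedSpace (EuclideanSpace ℝ (Fin (n i))) (M i)]
    [∀ i, IsManifold (𝓡 (n i)) ∞ (M i)] {N : ℕ} {g : ∀ i, RiemMetric (n i) (M i)}
    {o ξ : Minkowski (N + 1)} {G : ∀ i, M i → Minkowski (N + 1)}
    {A : ∀ i, EuclideanSpace ℝ (Fin (n i)) →ₗ[ℝ] Minkowski (N + 1)}

namespace IsLightConeSplitting

/-- The linear map `z ↦ (Aᵢ* z, r * ⟪z, o⟫)`. Up to a translation it gives the coordinates of `G i`
in the frame consisting of `A i` and a normal vector in the span of `o` and `ξ`. -/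
def coords (A : ∀ i, EuclideanSpace ℝ (Fin (n i)) →ₗ[ℝ] Minkowski (N + 1)) (o : Minkowski (N + 1))
    (i : Fin k) (r : ℝ) : Minkowski (N + 1) →L[ℝ] EuclideanSpace ℝ (Fin (n i + 1)) :=
  (appendCoord (n i)).comp ((lorentzAdjoint (A i)).prod (r • (lorentzL (N + 1)).flip o))

/-- As `ε² = 1`, the component of `G i` in the plane of `o` and `ξ` is `ε ⟨G i, o⟩ • (μ • o + ε •
ξ)`, a multiple of the normal vector used here. The constant last coordinate `r⁻¹` contributes the
centre. -/
theorem extendLast_coords (h : IsLightConeSplitting g o ξ G A) {i : Fin k} {μ r ε : ℝ}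
    (hr : r ≠ 0) (hε : ε ^ 2 = 1)
    (hG : ∀ x, lorentz (G i x) ξ = ε * μ * lorentz (G i x) o) (x : M i) :
    extendLast (A i) (r⁻¹ • (μ • o + ε • ξ))
        (coords A o i (ε * r) (G i x) + appendCoord (n i) (0, r⁻¹))
      = (r ^ 2)⁻¹ • (μ • o + ε • ξ) + G i x := by
  have h1 : coords A o i (ε * r) (G i x) + appendCoord (n i) (0, r⁻¹)
      = appendCoord (n i) (lorentzAdjoint (A i) (G i x), ε * r * lorentz (G i x) o + r⁻¹) := by
    have : (lorentzAdjoint (A i) (G i x), ε * r * lorentz (G i x) o + r⁻¹)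
      = (lorentzAdjoint (A i) (G i x), ε * r * lorentz (G i x) o) + (0, r⁻¹) := by simp
    rw [this, map_add]
    rfl
  rw [h1, extendLast_appendCoord]
  conv_rhs => rw [h.G_eq i x, hG]
  simp only [smul_add, smul_smul]
  have e1 : (ε * r * lorentz (G i x) o + r⁻¹) * (r⁻¹ * μ)
      = (r ^ 2)⁻¹ * μ + ε * μ * lorentz (G i x) o := by
    field_simp
    ring
  have e2 : (ε * r * lorentz (G i x) o + r⁻¹) * (r⁻¹ * ε)
      = (r ^ 2)⁻¹ * ε + lorentz (G i x) o := by
    field_simp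
    linear_combination r ^ 2 * lorentz (G i x) o * hε
  rw [e1, e2, add_smul, add_smul]
  abel

/-- For `r² = 2 μ` the cross terms add up to `2 ⟨o, G i⟩`, which cancels `⟨G i, G i⟩` by the
quadratic relation. Only the square of the centre remains. -/
theorem lorentz_center_add (h : IsLightConeSplitting g o ξ G A) {i : Fin k} {μ r ε : ℝ}
    (hr : r ≠ 0) (hε : ε ^ 2 = 1) (hμ : r ^ 2 = 2 * μ)
    (hG : ∀ x, lorentz (G i x) ξ = ε * μ * lorentz (G i x) o) (x : M i) :
    lorentz ((r ^ 2)⁻¹ • (μ • o + ε • ξ) + G i x) ((r ^ 2)⁻¹ • (μ • o + ε • ξ) + G i x)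
      = ε / r ^ 2 := by
  have hμ0 : μ ≠ 0 := by
    rintro rfl
    exact hr (by simpa using hμ)
  have h1 := h.G_G_same i x
  have h2 := hG x
  simp only [lorentz_add_left, lorentz_add_right, lorentz_smul_left, lorentz_smul_right, h.o_o,
    h.ξ_ξ, h.o_ξ, lorentz_comm ξ o, lorentz_comm o (G i x), lorentz_comm ξ (G i x), h2] at h1 ⊢
  rw [hμ]
  field_simp
  linear_combination 4 * μ ^ 2 * h1 + 4 * μ ^ 2 * lorentz (G i x) o * hε

theorem lorentz_normal (h : IsLightConeSplitting g o ξ G A) {μ r ε : ℝ}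
    (hr : r ≠ 0) (hμ : r ^ 2 = 2 * μ) :
    lorentz (r⁻¹ • (μ • o + ε • ξ)) (r⁻¹ • (μ • o + ε • ξ)) = ε := by
  simp only [lorentz_add_left, lorentz_add_right, lorentz_smul_left, lorentz_smul_right, h.o_o,
    h.ξ_ξ, h.o_ξ, lorentz_comm ξ o]
  field_simp
  linear_combination -ε * hμ

theorem lorentz_A_normal (h : IsLightConeSplitting g o ξ G A) {μ r ε : ℝ} (i : Fin k)
    (u : EuclideanSpace ℝ (Fin (n i))) : lorentz (A i u) (r⁻¹ • (μ • o + ε • ξ)) = 0 := by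
  simp only [lorentz_add_right, lorentz_smul_right, h.A_o, h.A_ξ]
  ring

/-- The second form of a conformal immersion of a product. -/
theorem exists_theta_form (h : IsLightConeSplitting g o ξ G A) (hN : ∑ i, n i = N)
    (T : LightConeTriple N) {f : (∀ i, M i) → EuclideanSpace ℝ (Fin N)} {ρ : (∀ i, M i) → ℝ}
    (hρ : ∀ p, 0 < ρ p) (hf : ∀ p, ρ p • T.embed (f p) = o + ∑ i, G i (p i))
    [∀ i, ConnectedSpace (M i)] {i j : Fin k} (hij : i ≠ j) (hall : ∀ l, l = i ∨ l = j) {μ : ℝ}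
    (hμ : 0 < μ) (hi : ∀ x, lorentz (G i x) ξ = -μ * lorentz (G i x) o)
    (hj : ∀ y, lorentz (G j y) ξ = μ * lorentz (G j y) o) :
    k = 2 ∧ ∃ i j : Fin k, i ≠ j ∧ ∃ c : ℝ, 0 < c ∧
      ∃ (f₁ : M i → Minkowski (n i)) (f₂ : M j → EuclideanSpace ℝ (Fin (n j + 1)))
        (T : LightConeTriple N) (S : LorentzSplitting N (n i) (n j)),
        IsLocalIsometryHyperbolic (g i) c f₁ ∧ IsLocalIsometrySphere (g j) c f₂ ∧
        IsConformalDiffeoOn (thetaDomain T S c) (conformalTheta T S) ∧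
        ∀ p, (f₁ (p i), f₂ (p j)) ∈ thetaDomain T S c ∧
          f p = conformalTheta T S (f₁ (p i), f₂ (p j)) := by
  have huniv : (Finset.univ : Finset (Fin k)) = {i, j} := by
    ext l
    simpa using hall l
  have hk : k = 2 := by
    rw [← Fintype.card_fin k, ← Finset.card_univ, huniv, Finset.card_pair hij]
  -- The vectors `μ • o ± ξ` have Lorentz squares `±2 μ`, so division by `r = √(2 μ)` makes them
  -- unit vectors. The curvature constant is `c = r²`.
  obtain ⟨r, hr, hrμ⟩ : ∃ r : ℝ, 0 < r ∧ r ^ 2 = 2 * μ :=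
    ⟨√(2 * μ), Real.sqrt_pos.2 (by linarith), Real.sq_sqrt (by linarith)⟩
  have hi' : ∀ x, lorentz (G i x) ξ = (-1) * μ * lorentz (G i x) o := fun x => by
    rw [hi, neg_one_mul]
  have hj' : ∀ x, lorentz (G j x) ξ = 1 * μ * lorentz (G j x) o := fun x => by
    rw [hj, one_mul]
  have hm1 : (-1 : ℝ) ^ 2 = 1 := by norm_num
  have hp1 : (1 : ℝ) ^ 2 = 1 := by norm_num
  set η₁ := r⁻¹ • (μ • o + (-1 : ℝ) • ξ) with hη₁
  set η₂ := r⁻¹ • (μ • o + (1 : ℝ) • ξ) with hη₂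
  have hη : lorentz η₁ η₂ = 0 := by
    simp only [hη₁, hη₂, lorentz_add_left, lorentz_add_right, lorentz_smul_left,
      lorentz_smul_right, h.o_o, h.ξ_ξ, h.o_ξ, lorentz_comm ξ o]
    ring
  have hC : ∀ x y : Minkowski (n i), lorentz (extendLast (A i) η₁ x) (extendLast (A i) η₁ y)
      = lorentz x y := fun x y => by
    rw [lorentz_extendLast (h.A_A_same i) (h.lorentz_A_normal i), h.lorentz_normal hr.ne' hrμ,
      lorentz]
    ring
  have hD : ∀ x y : EuclideanSpace ℝ (Fin (n j + 1)),
      lorentz (extendLast (A j) η₂ x) (extendLast (A j) η₂ y) = inner ℝ x y := fun x y => by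
    rw [lorentz_extendLast (h.A_A_same j) (h.lorentz_A_normal j), h.lorentz_normal hr.ne' hrμ,
      PiLp.inner_apply, Fin.sum_univ_castSucc]
    simp [mul_comm]
  let S : LorentzSplitting N (n i) (n j) :=
    { C := extendLast (A i) η₁
      D := extendLast (A j) η₂
      dim := by rw [← hN, huniv, Finset.sum_pair hij]
      lorentz_C := hC
      lorentz_D := hD
      lorentz_C_D := fun x y => by
        rw [extendLast_apply, extendLast_apply, lorentz_add_left, lorentz_add_right,
          lorentz_add_right, h.A_A i j hij, lorentz_smul_right, h.lorentz_A_normal,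
          lorentz_smul_left, lorentz_comm, h.lorentz_A_normal, lorentz_smul_left,
          lorentz_smul_right, hη]
        ring }
  set f₁ : M i → Minkowski (n i) :=
    fun x => coords A o i ((-1) * r) (G i x) + appendCoord (n i) (0, r⁻¹) with hf₁
  set f₂ : M j → EuclideanSpace ℝ (Fin (n j + 1)) :=
    fun x => coords A o j (1 * r) (G j x) + appendCoord (n j) (0, r⁻¹) with hf₂
  have hCf : ∀ x, extendLast (A i) η₁ (f₁ x) = (r ^ 2)⁻¹ • (μ • o + (-1 : ℝ) • ξ) + G i x :=
    h.extendLast_coords hr.ne' hm1 hi'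
  have hDf : ∀ x, extendLast (A j) η₂ (f₂ x) = (r ^ 2)⁻¹ • (μ • o + (1 : ℝ) • ξ) + G j x :=
    h.extendLast_coords hr.ne' hp1 hj'
  have hsm₁ : ContMDiff (𝓡 (n i)) 𝓘(ℝ, Minkowski (n i)) ∞ f₁ :=
    ((coords A o i ((-1) * r)).contDiff.add contDiff_const).contMDiff.comp (h.contMDiff i)
  have hsm₂ : ContMDiff (𝓡 (n j)) 𝓘(ℝ, EuclideanSpace ℝ (Fin (n j + 1))) ∞ f₂ :=
    ((coords A o j (1 * r)).contDiff.add contDiff_const).contMDiff.comp (h.contMDiff j)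
  have hq₁ : ∀ x, lorentz (f₁ x) (f₁ x) = -1 / r ^ 2 := fun x => by
    rw [← hC, hCf, h.lorentz_center_add hr.ne' hm1 hrμ hi']
  have hc : 0 < r ^ 2 := by positivity
  -- The last coordinate of a time-like vector never vanishes. On the connected factor it keeps the
  -- sign that it has at a zero of `G i`, where it equals `r⁻¹`.
  have hpos : ∀ x, 0 < f₁ x (Fin.last (n i)) := by
    have hcont : Continuous fun x => f₁ x (Fin.last (n i)) :=
      (EuclideanSpace.proj (Fin.last (n i)) : Minkowski (n i) →L[ℝ] ℝ).continuous.comp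
        hsm₁.continuous
    have hne : ∀ x, f₁ x (Fin.last (n i)) ≠ 0 := by
      intro x hx
      have h1 := hq₁ x
      rw [lorentz, hx] at h1
      have h2 : 0 ≤ ∑ l : Fin (n i), f₁ x l.castSucc * f₁ x l.castSucc :=
        Finset.sum_nonneg fun l _ => mul_self_nonneg _
      have h3 : -1 / r ^ 2 < 0 := div_neg_of_neg_of_pos (by norm_num) hc
      linarith
    obtain ⟨x₀, hx₀⟩ := h.exists_eq_zero i
    have h0 : 0 ≤ f₁ x₀ (Fin.last (n i)) := by
      simp only [hf₁, hx₀, map_zero, zero_add, appendCoord_last]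
      positivity
    intro x
    by_contra! hx
    obtain ⟨y, hy⟩ := mem_range_of_exists_le_of_exists_ge hcont ⟨x, hx⟩ ⟨x₀, h0⟩
    exact hne y hy
  refine ⟨hk, i, j, hij, r ^ 2, hc, f₁, f₂, T, S, ⟨fun x => ⟨hq₁ x, hpos x⟩, hsm₁, fun x u v => ?_⟩,
    ⟨fun x => ?_, hsm₂, fun x u v => ?_⟩, isConformalDiffeoOn_conformalTheta T S hc, fun p => ?_⟩
  · rw [← hC, eq_of_extendLast_comp hCf (h.mdifferentiableAt i x),
      eq_of_extendLast_comp hCf (h.mdifferentiableAt i x), h.isometric]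
  · change inner ℝ (f₂ x) (f₂ x) = 1 / r ^ 2
    rw [← hD, hDf, h.lorentz_center_add hr.ne' hp1 hrμ hj']
  · rw [← hD, eq_of_extendLast_comp hDf (h.mdifferentiableAt j x),
      eq_of_extendLast_comp hDf (h.mdifferentiableAt j x), h.isometric]
  · have hz : S.C (f₁ (p i)) + S.D (f₂ (p j)) = ρ p • T.embed (f p) := by
      change extendLast (A i) η₁ (f₁ (p i)) + extendLast (A j) η₂ (f₂ (p j)) = _
      rw [hCf, hDf, hf, huniv, Finset.sum_pair hij]
      -- The two centres add up to `o`, so `C f₁ + D f₂` is the lift of `f`.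
      have e : (r ^ 2)⁻¹ • (μ • o + (-1 : ℝ) • ξ) + (r ^ 2)⁻¹ • (μ • o + (1 : ℝ) • ξ) = o := by
        rw [← smul_add, neg_smul, one_smul, add_add_add_comm, neg_add_cancel, add_zero, ← add_smul,
          smul_smul, hrμ, ← two_mul, inv_mul_cancel₀ (by positivity), one_smul]
      rw [add_add_add_comm, e]
    refine ⟨⟨⟨hq₁ _, hpos _⟩, ?_, ?_⟩, ?_⟩
    · change inner ℝ (f₂ (p j)) (f₂ (p j)) = 1 / r ^ 2
      rw [← hD, hDf, h.lorentz_center_add hr.ne' hp1 hrμ hj']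
    · change lorentz (S.C (f₁ (p i)) + S.D (f₂ (p j))) T.w ≠ 0
      rw [hz, lorentz_smul_left, T.lorentz_embed_w, mul_one]
      exact (hρ p).ne'
    · change f p = T.toEuclidean (S.C (f₁ (p i)) + S.D (f₂ (p j)))
      rw [hz, T.toEuclidean_smul_embed (hρ p).ne']

end IsLightConeSplitting

end

/-! ### Assembly of the two cases. -/

theorem corollary4p4 {k : ℕ} (hk : 2 ≤ k) {n : Fin k → ℕ} (hn : ∀ i, 1 ≤ n i)
    {N : ℕ} (hN : ∑ i, n i = N) (hN3 : 3 ≤ N)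
    {M : Fin k → Type*} [∀ i, TopologicalSpace (M i)] [∀ i, T2Space (M i)]
    [∀ i, SecondCountableTopology (M i)] [∀ i, ConnectedSpace (M i)]
    [∀ i, ChartedSpace (EuclideanSpace ℝ (Fin (n i))) (M i)]
    [∀ i, IsManifold (𝓡 (n i)) ∞ (M i)]
    (g : ∀ i, RiemMetric (n i) (M i))
    (f : (∀ i, M i) → EuclideanSpace ℝ (Fin N)) (hf : IsConformalLocalDiffeo g f) :
    -- first form: the inversion may be absent
    (∃ (Φ : PiLp 2 (fun i => EuclideanSpace ℝ (Fin (n i))) ≃ᵢ EuclideanSpace ℝ (Fin N))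
        (F : ∀ i, M i → EuclideanSpace ℝ (Fin (n i)))
        (H : EuclideanSpace ℝ (Fin N) → EuclideanSpace ℝ (Fin N)),
      (∀ i, IsLocalIsometryEuclidean (g i) (F i)) ∧
      (∃ (a : EuclideanSpace ℝ (Fin N)) (r : ℝ), 0 < r ∧ H = AffineMap.homothety a r) ∧
      ((∀ p, f p = H (Φ (WithLp.toLp 2 fun i => F i (p i)))) ∨
        ∃ (b : EuclideanSpace ℝ (Fin N)) (s : ℝ), 0 < s ∧
          ∀ p, H (Φ (WithLp.toLp 2 fun i => F i (p i))) ≠ b ∧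
            f p = EuclideanGeometry.inversion b s (H (Φ (WithLp.toLp 2 fun i => F i (p i)))))) ∨
    -- second form
    (k = 2 ∧ ∃ i j : Fin k, i ≠ j ∧ ∃ c : ℝ, 0 < c ∧
      ∃ (f₁ : M i → Minkowski (n i)) (f₂ : M j → EuclideanSpace ℝ (Fin (n j + 1)))
        (T : LightConeTriple N) (S : LorentzSplitting N (n i) (n j)),
        IsLocalIsometryHyperbolic (g i) c f₁ ∧ IsLocalIsometrySphere (g j) c f₂ ∧
        IsConformalDiffeoOn (thetaDomain T S c) (conformalTheta T S) ∧
        ∀ p, (f₁ (p i), f₂ (p j)) ∈ thetaDomain T S c ∧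
          f p = conformalTheta T S (f₁ (p i), f₂ (p j))) := by
  let T := LightConeTriple.std N
  have hne : ∀ i, Nonempty (M i) := fun i => inferInstance
  let p₀ : ∀ i, M i := fun i => (hne i).some
  obtain ⟨ρ, G, hρ, hsplit, hG0, hGs, hiso⟩ := exists_lightCone_splitting T hk hn hN hN3 g hf p₀
  -- Completion to a light cone triple requires a nonzero light-like vector; the positivity of `ρ`
  -- and `⟨T.embed x, w⟩ = 1` ensure this.
  have ho : ρ p₀ • T.embed (f p₀) ≠ 0 := by
    intro h0
    have := T.lorentz_embed_w (f p₀)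
    rw [(smul_eq_zero.1 h0).resolve_left (hρ p₀).ne', lorentz_zero_left] at this
    exact zero_ne_one this
  obtain ⟨ξ, A, h⟩ := exists_isLightConeSplitting hN g ho (p₀ := p₀) (G := G)
    (fun p => by
      rw [← hsplit, lorentz_smul_left, lorentz_smul_right, T.lorentz_embed_self, mul_zero,
        mul_zero]) hG0 hGs hiso
  rcases h.dichotomy hk hn with hξ | ⟨i, j, hij, hall, μ, hμ, hi, hj⟩
  · exact Or.inl (h.exists_euclidean_form hN hξ T hρ hsplit)
  · exact Or.inr (h.exists_theta_form hN T hρ hsplit hij hall hμ hi hj)
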